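/- Let $F$ be a field of characteristic $0$ (for instance $F=\mathbb C$) and $n\ge 0$. An *exp-polynomial function* $\mathbb Z^r\to F$ in the variables $n_1,\dots,n_r$ is an element of the $F$-algebra of functions generated by the functions $n_j$ and $a^{n_j}$ ($a\in F\setminus\{0\}$, $1\le j\le r$). Let $G=\bigoplus_{\alpha\in\mathbb Z^n}G_\alpha$ be a $\mathbb Z^n$-graded Lie algebra over $F$ which is a *$\mathbb Z^n$-extragraded exp-polynomial Lie algebra*. This means the following. - $G$ is spanned by elements $g_k(\alpha)\in G_\alpha$ ($k\in K$, $\alpha\in\mathbb Z^n$), and there are exp-polynomial functions $f_{k,r}^s(\alpha,\beta)$ in $2n$ variables ($k,r,s\in K$), for fixed $k,r$ nonzero for only finitely many $s$, with $$[g_k(\alpha),g_r(\beta)]=\sum_{s\in K} f_{k,r}^s(\alpha,\beta)\,g_s(\alpha+\beta)\qquad\text{for all }k,r\in K,\ \alpha,\beta\in\mathbb Z^n .$$ - $G$ has a further Lie algebra grading $G=\bigoplus_{i\in\mathbb Z}G^{(i)}$, and $K$ is a disjoint union of finite sets $K_i$ ($i\in\mathbb Z$) such that, for each $i$, the elements $g_k(\alpha)$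 with $k\in K_i$, $\alpha\in\mathbb Z^n$ lie in $G^{(i)}$ and span $G^{(i)}$. Let $J$ be a finite set and let $V$ be a $\mathbb Z^n$-graded exp-polynomial $G^{(0)}$-module: $V$ is a $G^{(0)}$-module with a basis $v_j(\alpha)$ ($j\in J$, $\alpha\in\mathbb Z^n$), and there are exp-polynomial functions $h_{k,j}^s(\alpha,\beta)$ in $2n$ variables with $$g_k(\alpha)v_j(\beta)=\sum_{s\in J}h_{k,j}^s(\alpha,\beta)\,v_s(\alpha+\beta)\qquad\text{for all }k\in K_0,\ j\in J,\ \alpha,\beta\in\mathbb Z^n .$$ Put $V_\alpha=\operatorname{span}\{v_j(\alpha)\mid j\in J\}$. Let $G^+=\bigoplus_{i\ge1}G^{(i)}$ act on $V$ by zero, and let $\widetilde M(V)=\operatorname{Ind}^G_{G^{(0)}+G^+}V=U(G)\otimes_{U(G^{(0)}+G^+)}V$. For $(i,\alpha)\in\mathbb Z\times\mathbb Z^n$ let $\widetilde M(V)^{(i)}_\alpha$ be the span of the elements $x_1\cdots x_s\otimes y$ with $s\ge0$, $x_p\in G^{(i_p)}\cap G_{\alpha_p}$, $y\in V_\beta$,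 $i_1+\dots+i_s=i$ and $\alpha_1+\dots+\alpha_s+\beta=\alpha$; a submodule of $\widetilde M(V)$ is called graded if each of its elements is a sum of elements of it that lie in these components. Then the sum $\widetilde M^{rad}$ of all graded submodules of $\widetilde M(V)$ which intersect $V=1\otimes V$ trivially is itself such a submodule, that is, it is the largest one. Let $M(V)=\widetilde M(V)/\widetilde M^{rad}$, and let $M(V)^{(i)}_\alpha$ be the image of $\widetilde M(V)^{(i)}_\alpha$. Then $$M(V)=\bigoplus_{(i,\alpha)\in\mathbb Z\times\mathbb Z^n}M(V)^{(i)}_\alpha\qquad\text{and}\qquad \dim M(V)^{(i)}_\alpha<\infty\quad\text{for all } i\in\mathbb Z,\ \alpha\in\mathbb Z^n .$$ -/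

import Mathlib

open scoped DirectSum TensorProduct

noncomputable section

namespace ExpPolyLie

attribute [local instance] LieRing.ofAssociativeRing

/-! ### Exp-polynomial functions, Lie algebras and modules -/

section ExpPoly

/-- The algebra of exp-polynomial functions `ℤ^ι → F` in the variables `n_j`, `j ∈ ι`: it is
generated by the functions `n ↦ n_j` and `n ↦ a ^ n_j` with `a ∈ F \ {0}`. -/
def expPolynomial (F : Type*) [Field F] (ι : Type*) : Subalgebra F ((ι → ℤ) → F) :=
  Algebra.adjoin F
    (Set.range (fun (j : ι) (n : ι → ℤ) => (n j : F)) ∪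
      Set.range (fun (p : Fˣ × ι) (n : ι → ℤ) => (p.1 : F) ^ n p.2))

/-- Exp-polynomial functions in `2n` variables, grouped as `(α, β) ∈ ℤⁿ × ℤⁿ`. -/
abbrev ExpPoly₂ (F : Type*) [Field F] (n : ℕ) : Type _ := expPolynomial F (Fin n ⊕ Fin n)

/-- The value `f(α, β)`. -/
def ExpPoly₂.eval {F : Type*} [Field F] {n : ℕ} (f : ExpPoly₂ F n) (α β : Fin n → ℤ) : F :=
  (f : (Fin n ⊕ Fin n → ℤ) → F) (Sum.elim α β)

/-- The family `g_k(α)`, `k ∈ K`, `α ∈ ℤⁿ`, is a distinguished spanning set which makes the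
`ℤⁿ`-graded Lie algebra `G = ⨁ 𝒜 α` an exp-polynomial Lie algebra. The structure functions
`f_{k,r}^s`, of which for given `k, r` only finitely many are nonzero, are recorded as a finitely
supported function of `s`. -/
structure IsExpPolynomialLie {F G : Type*} [Field F] [LieRing G] [LieAlgebra F G] {n : ℕ}
    (𝒜 : (Fin n → ℤ) → Submodule F G) [GradedLieAlgebra 𝒜] {K : Type*}
    (g : K → (Fin n → ℤ) → G) : Prop where
  mem : ∀ k α, g k α ∈ 𝒜 α
  span_eq_top : Submodule.span F {x | ∃ k α, x = g k α} = ⊤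
  exists_structure : ∃ f : K → K → K →₀ ExpPoly₂ F n, ∀ k r α β,
    ⁅g k α, g r β⁆ = (f k r).sum fun s c => c.eval α β • g s (α + β)

/-- The module `V` over the Lie algebra `L` with distinguished spanning set `g_k(α)` is a
`ℤⁿ`-graded exp-polynomial module with respect to its basis `v_j(β)`, `j ∈ J`, `β ∈ ℤⁿ`.
Here `J` may be infinite. -/
def IsExpPolynomialModule {F L V : Type*} [Field F] [LieRing L] [LieAlgebra F L]
    [AddCommGroup V] [Module F V] [LieRingModule L V] [LieModule F L V] {n : ℕ} {K J : Type*}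
    (g : K → (Fin n → ℤ) → L) (v : Module.Basis (J × (Fin n → ℤ)) F V) : Prop :=
  ∃ h : K → J → J →₀ ExpPoly₂ F n, ∀ k j α β,
    ⁅g k α, v (j, β)⁆ = (h k j).sum fun s c => c.eval α β • v (s, α + β)

/-- The homogeneous component `V_α`, spanned by the `v_j(α)`, `j ∈ J`. -/
def moduleComponent {F V : Type*} [Field F] [AddCommGroup V] [Module F V] {n : ℕ} {J : Type*}
    (v : Module.Basis (J × (Fin n → ℤ)) F V) (α : Fin n → ℤ) : Submodule F V :=
  Submodule.span F (Set.range fun j => v (j, α))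

/-- The exp-polynomial Lie algebra `G` with its distinguished spanning set `g_k(α)` is
`ℤⁿ`-extragraded: there is a further `ℤ`-grading `G = ⨁ ℬ i`, and `K` is the disjoint union of the
finite sets `K_i = {k | deg k = i}`, such that the `g_k(α)` with `k ∈ K_i` lie in `ℬ i` and
span it. -/
structure IsExtragraded {F G : Type*} [Field F] [LieRing G] [LieAlgebra F G] {n : ℕ}
    (𝒜 : (Fin n → ℤ) → Submodule F G) [GradedLieAlgebra 𝒜]
    (ℬ : ℤ → Submodule F G) [GradedLieAlgebra ℬ] {K : Type*}
    (g : K → (Fin n → ℤ) → G) (deg : K → ℤ) : Prop where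
  isExpPolynomialLie : IsExpPolynomialLie 𝒜 g
  finite_deg : ∀ i, {k | deg k = i}.Finite
  mem : ∀ k α, g k α ∈ ℬ (deg k)
  span_eq : ∀ i, Submodule.span F {x | ∃ k α, deg k = i ∧ x = g k α} = ℬ i

end ExpPoly

/-! ### The subalgebras `G⁽⁰⁾` and `G⁽⁰⁾ + G⁺` of a `ℤ`-graded Lie algebra -/

section Parts

variable {F G : Type*} [Field F] [LieRing G] [LieAlgebra F G]
  (ℬ : ℤ → Submodule F G) [GradedLieAlgebra ℬ]

/-- The subalgebra `G⁽⁰⁾`. -/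
def zeroPart : LieSubalgebra F G :=
  { ℬ 0 with
    lie_mem' := fun {x y} hx hy => by
      have h := SetLike.GradedBracket.bracket_mem (ℒ := ℬ) (i := 0) (j := 0) hx hy
      simpa using h }

/-- The subalgebra `G⁽⁰⁾ + G⁺`, where `G⁺ = ⨁_{i ≥ 1} G⁽ⁱ⁾`. -/
def nonnegPart : LieSubalgebra F G :=
  { ℬ 0 ⊔ ⨆ i : {i : ℤ // 1 ≤ i}, ℬ i with
    lie_mem' := fun {x y} hx hy => by
      have key : (ℬ 0 ⊔ ⨆ i : {i : ℤ // 1 ≤ i}, ℬ i) = ⨆ i : {i : ℤ // 0 ≤ i}, ℬ i := by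
        apply le_antisymm
        · refine sup_le (le_iSup (fun i : {i : ℤ // 0 ≤ i} => ℬ i) ⟨0, le_rfl⟩) ?_
          refine iSup_le fun i => ?_
          exact le_iSup (fun i : {i : ℤ // 0 ≤ i} => ℬ i) ⟨i.1, by have := i.2; omega⟩
        · refine iSup_le fun i => ?_
          rcases eq_or_lt_of_le i.2 with h | h
          · rw [← h]; exact le_sup_left
          · exact le_sup_of_le_right
              (le_iSup (fun i : {i : ℤ // 1 ≤ i} => ℬ i) ⟨i.1, by omega⟩)
      change ⁅x, y⁆ ∈ (ℬ 0 ⊔ ⨆ i : {i : ℤ // 1 ≤ i}, ℬ i)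
      change x ∈ (ℬ 0 ⊔ ⨆ i : {i : ℤ // 1 ≤ i}, ℬ i) at hx
      change y ∈ (ℬ 0 ⊔ ⨆ i : {i : ℤ // 1 ≤ i}, ℬ i) at hy
      rw [key] at hx hy ⊢
      induction hx using Submodule.iSup_induction' with
      | mem i x hx =>
        induction hy using Submodule.iSup_induction' with
        | mem j y hy =>
          exact Submodule.mem_iSup_of_mem
            (⟨i.1 + j.1, add_nonneg i.2 j.2⟩ : {i : ℤ // 0 ≤ i})
            (SetLike.GradedBracket.bracket_mem (ℒ := ℬ) hx hy)
        | zero => simp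
        | add y z _ _ hy hz => rw [lie_add]; exact add_mem hy hz
      | zero => simp
      | add x z _ _ hx hz => rw [add_lie]; exact add_mem hx hz }

/-- The component of degree `0`, as a linear map `G → G⁽⁰⁾`. -/
def zeroComponent : G →ₗ[F] zeroPart ℬ :=
  (DirectSum.component F ℤ (fun i => ℬ i) 0).comp
    (DirectSum.decomposeLinearEquiv ℬ).toLinearMap

lemma coe_zeroComponent (x : G) :
    (zeroComponent ℬ x : G) = (DirectSum.decompose ℬ x 0 : G) := rfl

lemma zeroComponent_of_mem {x : G} (hx : x ∈ ℬ 0) : (zeroComponent ℬ x : G) = x := by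
  rw [coe_zeroComponent, DirectSum.decompose_of_mem_same ℬ hx]

lemma zeroComponent_of_mem_ne {x : G} {i : ℤ} (hx : x ∈ ℬ i) (hi : i ≠ 0) :
    zeroComponent ℬ x = 0 := by
  apply Subtype.ext
  rw [coe_zeroComponent, DirectSum.decompose_of_mem_ne ℬ hx hi]
  rfl

lemma zeroComponent_of_mem_iSup {x : G} (hx : x ∈ ⨆ i : {i : ℤ // 1 ≤ i}, ℬ i) :
    zeroComponent ℬ x = 0 := by
  induction hx using Submodule.iSup_induction' with
  | mem i x hx => exact zeroComponent_of_mem_ne ℬ hx (by have := i.2; omega)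
  | zero => simp
  | add x z _ _ hx hz => simp [hx, hz]

/-- On `G⁽⁰⁾ + G⁺` the projection onto `G⁽⁰⁾` with kernel `G⁺` is a homomorphism of Lie
algebras. -/
def nonnegToZero : nonnegPart ℬ →ₗ⁅F⁆ zeroPart ℬ :=
  { (zeroComponent ℬ).comp (nonnegPart ℬ).toSubmodule.subtype with
    map_lie' := fun {x y} => by
      have key : ∀ {i j : ℤ} {a b : G}, 0 ≤ i → 0 ≤ j → a ∈ ℬ i → b ∈ ℬ j →
          zeroComponent ℬ ⁅a, b⁆ = ⁅zeroComponent ℬ a, zeroComponent ℬ b⁆ := by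
        intro i j a b hi hj ha hb
        have hab := SetLike.GradedBracket.bracket_mem (ℒ := ℬ) ha hb
        by_cases h0 : i = 0
        · by_cases h1 : j = 0
          · subst h0; subst h1
            apply Subtype.ext
            rw [LieSubalgebra.coe_bracket, zeroComponent_of_mem ℬ ha, zeroComponent_of_mem ℬ hb]
            exact zeroComponent_of_mem ℬ (by simpa using hab)
          · rw [zeroComponent_of_mem_ne ℬ hb h1, lie_zero]
            exact zeroComponent_of_mem_ne ℬ hab (by omega)
        · rw [zeroComponent_of_mem_ne ℬ ha h0, zero_lie]
          exact zeroComponent_of_mem_ne ℬ hab (by omega)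
      have main : ∀ a ∈ (ℬ 0 ⊔ ⨆ i : {i : ℤ // 1 ≤ i}, ℬ i),
          ∀ b ∈ (ℬ 0 ⊔ ⨆ i : {i : ℤ // 1 ≤ i}, ℬ i),
          zeroComponent ℬ ⁅a, b⁆ = ⁅zeroComponent ℬ a, zeroComponent ℬ b⁆ := by
        have left : ∀ {j : ℤ} {b : G}, 0 ≤ j → b ∈ ℬ j →
            ∀ a ∈ (ℬ 0 ⊔ ⨆ i : {i : ℤ // 1 ≤ i}, ℬ i),
            zeroComponent ℬ ⁅a, b⁆ = ⁅zeroComponent ℬ a, zeroComponent ℬ b⁆ := by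
          intro j b hj hb a ha
          obtain ⟨a₀, ha₀, a₁, ha₁, rfl⟩ := Submodule.mem_sup.1 ha
          have h₁ : zeroComponent ℬ ⁅a₁, b⁆ = ⁅zeroComponent ℬ a₁, zeroComponent ℬ b⁆ := by
            induction ha₁ using Submodule.iSup_induction' with
            | mem i x hx => exact key (by have := i.2; omega) hj hx hb
            | zero => simp
            | add x z hx' hz' hx hz =>
              rw [add_lie, map_add, map_add, add_lie,
                hx (Submodule.add_mem_sup ha₀ hx'), hz (Submodule.add_mem_sup ha₀ hz')]
          rw [add_lie, map_add, map_add, add_lie, h₁, key le_rfl hj ha₀ hb]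
        intro a ha b hb
        obtain ⟨b₀, hb₀, b₁, hb₁, rfl⟩ := Submodule.mem_sup.1 hb
        have h₁ : zeroComponent ℬ ⁅a, b₁⁆ = ⁅zeroComponent ℬ a, zeroComponent ℬ b₁⁆ := by
          induction hb₁ using Submodule.iSup_induction' with
          | mem i x hx => exact left (by have := i.2; omega) hx a ha
          | zero => simp
          | add x z hx' hz' hx hz =>
            rw [lie_add, map_add, map_add, lie_add,
              hx (Submodule.add_mem_sup hb₀ hx'), hz (Submodule.add_mem_sup hb₀ hz')]
        rw [lie_add, map_add, map_add, lie_add, h₁, left le_rfl hb₀ a ha]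
      exact main x.1 x.2 y.1 y.2 }

/-- A `G⁽⁰⁾`-module `V`, made into a representation of `G⁽⁰⁾ + G⁺` by letting `G⁺` act by zero. -/
def inflate (V : Type*) [AddCommGroup V] [Module F V] [LieRingModule (zeroPart ℬ) V]
    [LieModule F (zeroPart ℬ) V] : nonnegPart ℬ →ₗ⁅F⁆ Module.End F V :=
  (LieModule.toEnd F (zeroPart ℬ) V).comp (nonnegToZero ℬ)

lemma inflate_apply_zero {V : Type*} [AddCommGroup V] [Module F V]
    [LieRingModule (zeroPart ℬ) V] [LieModule F (zeroPart ℬ) V] (x : G) (hx : x ∈ ℬ 0) (y : V) :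
    inflate ℬ V ⟨x, Submodule.mem_sup_left hx⟩ y = ⁅(⟨x, hx⟩ : zeroPart ℬ), y⁆ := by
  have h : zeroComponent ℬ x = ⟨x, hx⟩ := Subtype.ext (zeroComponent_of_mem ℬ hx)
  change ⁅zeroComponent ℬ x, y⁆ = _
  rw [h]

lemma inflate_apply_pos {V : Type*} [AddCommGroup V] [Module F V]
    [LieRingModule (zeroPart ℬ) V] [LieModule F (zeroPart ℬ) V] (x : G)
    (hx : x ∈ ⨆ i : {i : ℤ // 1 ≤ i}, ℬ i) (y : V) :
    inflate ℬ V ⟨x, Submodule.mem_sup_right hx⟩ y = 0 := by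
  change ⁅zeroComponent ℬ x, y⁆ = _
  rw [zeroComponent_of_mem_iSup ℬ hx, zero_lie]

/-- The elements `g_k(α)`, `k ∈ K_0`: the distinguished spanning set of `G⁽⁰⁾`. -/
def zeroSpanningSet {n : ℕ} {K : Type*} {g : K → (Fin n → ℤ) → G} {deg : K → ℤ}
    (hg : ∀ k α, g k α ∈ ℬ (deg k)) (k : {k : K // deg k = 0}) (α : Fin n → ℤ) : zeroPart ℬ :=
  ⟨g k.1 α, by
    have h := hg k.1 α
    rw [k.2] at h
    exact h⟩

end Parts

/-! ### The induced module `U(G) ⊗_{U(P)} V` -/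

section Induced

variable {F G : Type*} [Field F] [LieRing G] [LieAlgebra F G]
  {V : Type*} [AddCommGroup V] [Module F V]

/-- The `U(G)`-submodule of `U(G) ⊗_F V` generated by the elements `u x ⊗ v - u ⊗ x v` with `x ∈ P`.
As `P` generates `U(P)`, the quotient by it is `U(G) ⊗_{U(P)} V`. -/
def indRel {P : LieSubalgebra F G} (ρ : P →ₗ⁅F⁆ Module.End F V) :
    Submodule (UniversalEnvelopingAlgebra F G) (UniversalEnvelopingAlgebra F G ⊗[F] V) :=
  Submodule.span _ {t | ∃ (u : UniversalEnvelopingAlgebra F G) (x : P) (y : V),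
    t = (u * UniversalEnvelopingAlgebra.ι F (x : G)) ⊗ₜ[F] y - u ⊗ₜ[F] (ρ x y)}

/-- The induced `G`-module `Ind_P^G V = U(G) ⊗_{U(P)} V`, as a `U(G)`-module, for a subalgebra `P`
of `G` and a representation `ρ` of `P` on `V`. -/
abbrev Ind {P : LieSubalgebra F G} (ρ : P →ₗ⁅F⁆ Module.End F V) : Type _ :=
  (UniversalEnvelopingAlgebra F G ⊗[F] V) ⧸ indRel ρ

/-- The class of `u ⊗ y` in the induced module. -/
def Ind.mk {P : LieSubalgebra F G} (ρ : P →ₗ⁅F⁆ Module.End F V)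
    (u : UniversalEnvelopingAlgebra F G) (y : V) : Ind ρ :=
  (indRel ρ).mkQ (u ⊗ₜ[F] y)

/-- The canonical map `V → Ind_P^G V`, `y ↦ 1 ⊗ y`. -/
def Ind.incl {P : LieSubalgebra F G} (ρ : P →ₗ⁅F⁆ Module.End F V) : V →ₗ[F] Ind ρ :=
  ((indRel ρ).mkQ.restrictScalars F).comp
    (TensorProduct.mk F (UniversalEnvelopingAlgebra F G) V 1)

/-- For a family `𝒢 γ` of subspaces of `G`, the monomial `x_1 ⋯ x_s` in `U(G)` with factors
`x_p ∈ 𝒢 γ_p` has degree `γ_1 + ⋯ + γ_s`; the empty monomial `1` has degree `0`. -/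
inductive IsMonomial {Γ : Type*} [AddMonoid Γ] (𝒢 : Γ → Submodule F G) :
    Γ → UniversalEnvelopingAlgebra F G → Prop
  | one : IsMonomial 𝒢 0 1
  | mul {γ δ : Γ} {x : G} {u : UniversalEnvelopingAlgebra F G} :
      x ∈ 𝒢 γ → IsMonomial 𝒢 δ u → IsMonomial 𝒢 (γ + δ) (UniversalEnvelopingAlgebra.ι F x * u)

/-- The homogeneous component of degree `γ` of the induced module: it is spanned by the classes
of `x_1 ⋯ x_s ⊗ y`, where the degrees of the homogeneous elements `x_1, …, x_s` of `G` and `y` of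
`V` add up to `γ`. -/
def indComponent {Γ : Type*} [AddMonoid Γ] (𝒢 : Γ → Submodule F G) (𝒱 : Γ → Submodule F V)
    {P : LieSubalgebra F G} (ρ : P →ₗ⁅F⁆ Module.End F V) (γ : Γ) : Submodule F (Ind ρ) :=
  Submodule.span F {m | ∃ (δ ε : Γ) (u : UniversalEnvelopingAlgebra F G) (y : V),
    δ + ε = γ ∧ IsMonomial 𝒢 δ u ∧ y ∈ 𝒱 ε ∧ m = Ind.mk ρ u y}

/-- The `G`-submodule `N` of a `G`-module `M` is graded, with respect to the homogeneous components
`ℳ γ` of `M`: every element of `N` is a sum of homogeneous elements of `N`. -/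
def IsGradedSubmodule {Γ M : Type*} [AddCommGroup M] [Module F M]
    [Module (UniversalEnvelopingAlgebra F G) M] [IsScalarTower F (UniversalEnvelopingAlgebra F G) M]
    (ℳ : Γ → Submodule F M) (N : Submodule (UniversalEnvelopingAlgebra F G) M) : Prop :=
  N.restrictScalars F ≤ ⨆ γ, N.restrictScalars F ⊓ ℳ γ

end Induced

/-! ### The modules `M̃(V)` and `M(V)` -/

section Main

variable {F G : Type*} [Field F] [LieRing G] [LieAlgebra F G] {n : ℕ}
  (𝒜 : (Fin n → ℤ) → Submodule F G) (ℬ : ℤ → Submodule F G) [GradedLieAlgebra ℬ]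
  {V : Type*} [AddCommGroup V] [Module F V] [LieRingModule (zeroPart ℬ) V]
  [LieModule F (zeroPart ℬ) V] (𝒱 : (Fin n → ℤ) → Submodule F V)

/-- The components `G⁽ⁱ⁾_α = G⁽ⁱ⁾ ∩ G_α` of the `ℤ^{n+1}`-grading of `G`. -/
def bigrading (γ : ℤ × (Fin n → ℤ)) : Submodule F G := ℬ γ.1 ⊓ 𝒜 γ.2

/-- The space `V`, graded by `ℤ^{n+1}` with `V_α` placed in degree `(0, α)`. -/
def bigradingModule (γ : ℤ × (Fin n → ℤ)) : Submodule F V := if γ.1 = 0 then 𝒱 γ.2 else ⊥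

variable (V) in
/-- The module `M̃(V)` induced from `G⁽⁰⁾ + G⁺` to `G`. -/
abbrev MTilde : Type _ := Ind (inflate ℬ V)

/-- The homogeneous component of `M̃(V)` of degree `γ = (i, α)`. -/
def MTilde.component (γ : ℤ × (Fin n → ℤ)) : Submodule F (MTilde ℬ V) :=
  indComponent (bigrading 𝒜 ℬ) (bigradingModule 𝒱) (inflate ℬ V) γ

/-- `N` is a `ℤ^{n+1}`-graded `G`-submodule of `M̃(V)` which intersects (the image of) `V`
trivially. -/
def IsGradedAvoiding (N : Submodule (UniversalEnvelopingAlgebra F G) (MTilde ℬ V)) : Prop :=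
  IsGradedSubmodule (MTilde.component 𝒜 ℬ 𝒱) N ∧
    N.restrictScalars F ⊓ LinearMap.range (Ind.incl (inflate ℬ V)) = ⊥

/-- The radical of `M̃(V)`: the sum of all graded submodules which intersect `V` trivially. -/
def MTilde.rad : Submodule (UniversalEnvelopingAlgebra F G) (MTilde ℬ V) :=
  sSup {N | IsGradedAvoiding 𝒜 ℬ 𝒱 N}

/-- The quotient module `M(V)` of `M̃(V)` by its radical. -/
abbrev MQuot : Type _ := MTilde ℬ V ⧸ MTilde.rad 𝒜 ℬ 𝒱

/-- The homogeneous component of `M(V)` of degree `γ = (i, α)`: the image of that of `M̃(V)`. -/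
def MQuot.component (γ : ℤ × (Fin n → ℤ)) : Submodule F (MQuot 𝒜 ℬ 𝒱) :=
  (MTilde.component 𝒜 ℬ 𝒱 γ).map ((MTilde.rad 𝒜 ℬ 𝒱).mkQ.restrictScalars F)

end Main

end ExpPolyLie

end

open scoped DirectSum TensorProduct

noncomputable section

namespace ExpPolyLie

attribute [local instance] LieRing.ofAssociativeRing

/-! Write `w(y)` for a word in the `g_k`, with fixed indices `k` (its type) and variable
`ℤⁿ`-arguments `y`. A homogeneous element `m` of `M̃(V)` of degree `γ` lies in the radical as soon
as every word carrying it back to `ℤ`-degree `0` kills it: the submodule generated by `m` is then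
graded and has nothing in degree `0`. Since `M̃(V)` vanishes in positive `ℤ`-degree, words whose
letters all have positive degree suffice (`mem_rad_of_pos`). As the sets `K_i` are finite, only
finitely many types of such words occur (`finite_lists_of_pos`). So `M(V)_γ` is a quotient of the
image of `M̃(V)_γ` under `m ↦ (y ↦ w(y) m)`, with `w` running over finitely many types. To bound
that image, `m` may be taken to be `w'(z) ⊗ v_j(β)` with `w'` of one of finitely many types with
negative letters (`component_le_span_neg`). Straightening `w(y) w'(z) ⊗ v_j(β)`
(`mk_word_mem_normalForms`) leaves elements of `V` whose coefficients are exp-polynomial in sums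
`A(y) + B(z)`. Such a function is a finite sum of products of a function of `y` and a function of
`z` (`isSubstClosed_finiteRank`), so as `z` varies the functions of `y` stay in one
finite-dimensional space. For the gradings, a multiplicative character of `ℤ × ℤⁿ` with distinct
values, built from primes, scales `G` and `V` compatibly, hence scales `M̃(V)`. The components lie
in eigenspaces for different eigenvalues, so they are independent; neither the
Poincaré–Birkhoff–Witt theorem nor injectivity of `V → M̃(V)` is used. Independence also turns
trivial intersection with `V` into containment in the part of nonzero `ℤ`-degree, a condition stable
under sums (`isGradedAvoiding_iff`). -/

/-! ### Words in the distinguished spanning set, with parameters -/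

section Words

variable {F G : Type*} [Field F] [LieRing G] [LieAlgebra F G] {n : ℕ} {K X : Type*}

/-- The product `g_{k_1}(L_1(x)) ⋯ g_{k_s}(L_s(x))` in `U(G)`, as a function of a parameter `x`. -/
def word (F : Type*) {G : Type*} [Field F] [LieRing G] [LieAlgebra F G] {n : ℕ} {K X : Type*}
    (g : K → (Fin n → ℤ) → G) (l : List (K × (X → Fin n → ℤ))) (x : X) :
    UniversalEnvelopingAlgebra F G :=
  (l.map fun p => UniversalEnvelopingAlgebra.ι F (g p.1 (p.2 x))).prod

/-- The `ℤ`-degree of a word. -/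
def wordDeg (deg : K → ℤ) (l : List (K × (X → Fin n → ℤ))) : ℤ :=
  (l.map fun p => deg p.1).sum

/-- The `ℤⁿ`-degree of a word. -/
def wordShift (l : List (K × (X → Fin n → ℤ))) : X → Fin n → ℤ :=
  (l.map Prod.snd).sum

@[simp] lemma word_nil (g : K → (Fin n → ℤ) → G) (x : X) : word F g [] x = 1 := rfl

@[simp] lemma word_cons (g : K → (Fin n → ℤ) → G) (p : K × (X → Fin n → ℤ)) (l) (x : X) :
    word F g (p :: l) x = UniversalEnvelopingAlgebra.ι F (g p.1 (p.2 x)) * word F g l x := by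
  simp [word]

@[simp] lemma word_append (g : K → (Fin n → ℤ) → G) (l l' : List (K × (X → Fin n → ℤ))) (x : X) :
    word F g (l ++ l') x = word F g l x * word F g l' x := by
  simp [word]

@[simp] lemma wordDeg_nil (deg : K → ℤ) : wordDeg deg ([] : List (K × (X → Fin n → ℤ))) = 0 := rfl

@[simp] lemma wordDeg_cons (deg : K → ℤ) (p : K × (X → Fin n → ℤ)) (l) :
    wordDeg deg (p :: l) = deg p.1 + wordDeg deg l := by
  simp [wordDeg]

@[simp] lemma wordDeg_append (deg : K → ℤ) (l l' : List (K × (X → Fin n → ℤ))) :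
    wordDeg deg (l ++ l') = wordDeg deg l + wordDeg deg l' := by
  simp [wordDeg]

@[simp] lemma wordShift_nil : wordShift ([] : List (K × (X → Fin n → ℤ))) = 0 := rfl

@[simp] lemma wordShift_cons (p : K × (X → Fin n → ℤ)) (l) :
    wordShift (p :: l) = p.2 + wordShift l := by
  simp [wordShift]

@[simp] lemma wordShift_append (l l' : List (K × (X → Fin n → ℤ))) :
    wordShift (l ++ l') = wordShift l + wordShift l' := by
  simp [wordShift]

lemma wordDeg_perm (deg : K → ℤ) {l l' : List (K × (X → Fin n → ℤ))} (h : l.Perm l') :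
    wordDeg deg l = wordDeg deg l' :=
  (h.map _).sum_eq

lemma wordShift_perm {l l' : List (K × (X → Fin n → ℤ))} (h : l.Perm l') :
    wordShift l = wordShift l' :=
  (h.map _).sum_eq

/-- Commutators of the `g_k(α)` are given by exp-polynomial functions, compatibly with the
`ℤ`-degrees. -/
def HasGradedBracket (F : Type*) {G : Type*} [Field F] [LieRing G] [LieAlgebra F G] {n : ℕ}
    {K : Type*} (g : K → (Fin n → ℤ) → G) (deg : K → ℤ) : Prop :=
  ∀ k r, ∃ f : K →₀ ExpPoly₂ F n, (∀ s ∈ f.support, deg s = deg k + deg r) ∧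
    ∀ α β, ⁅g k α, g r β⁆ = f.sum fun s c => c.eval α β • g s (α + β)

/-- Substituting functions in `Λ` into an exp-polynomial function gives a function in `E`. -/
def IsSubstClosed {F : Type*} [Field F] {n : ℕ} {X : Type*} (E : Subalgebra F (X → F))
    (Λ : AddSubmonoid (X → Fin n → ℤ)) : Prop :=
  ∀ f : ExpPoly₂ F n, ∀ L₁ ∈ Λ, ∀ L₂ ∈ Λ, (fun x => f.eval (L₁ x) (L₂ x)) ∈ E

/-- The choice that forgets the coefficients: over a one-point parameter space it turns
straightening into plain statements about spans. -/
lemma isSubstClosed_top : IsSubstClosed (F := F) (n := n) (X := X) ⊤ ⊤ :=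
  fun _ _ _ _ _ => trivial

/-- The span of the words of given degrees and of length less than `N`, with coefficients in `E`. -/
def shortWords (g : K → (Fin n → ℤ) → G) (deg : K → ℤ) (E : Subalgebra F (X → F))
    (Λ : AddSubmonoid (X → Fin n → ℤ)) (N : ℕ) (d : ℤ) (L : X → Fin n → ℤ) :
    Submodule F (X → UniversalEnvelopingAlgebra F G) :=
  Submodule.span F {Φ | ∃ c ∈ E, ∃ l : List (K × (X → Fin n → ℤ)), l.length < N ∧
    (∀ p ∈ l, p.2 ∈ Λ) ∧ wordDeg deg l = d ∧ wordShift l = L ∧ Φ = fun x => c x • word F g l x}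

variable {g : K → (Fin n → ℤ) → G} {deg : K → ℤ} {E : Subalgebra F (X → F)}
  {Λ : AddSubmonoid (X → Fin n → ℤ)}

lemma ι_mul_mem_shortWords {p : K × (X → Fin n → ℤ)} (hp : p.2 ∈ Λ) {N : ℕ} {d : ℤ}
    {L : X → Fin n → ℤ} {Φ : X → UniversalEnvelopingAlgebra F G}
    (hΦ : Φ ∈ shortWords g deg E Λ N d L) :
    (fun x => UniversalEnvelopingAlgebra.ι F (g p.1 (p.2 x)) * Φ x) ∈
      shortWords g deg E Λ (N + 1) (deg p.1 + d) (p.2 + L) := by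
  induction hΦ using Submodule.span_induction with
  | mem Φ h =>
    obtain ⟨c, hc, l, hl, hΛ, hd, hL, rfl⟩ := h
    refine Submodule.subset_span ⟨c, hc, p :: l, by simpa using hl, ?_, by simp [hd],
      by simp [hL], by simp⟩
    simpa [hp] using fun a b h => hΛ (a, b) h
  | zero => convert Submodule.zero_mem (shortWords g deg E Λ (N + 1) _ _) using 1; ext x; simp
  | add Φ Ψ _ _ h₁ h₂ => convert add_mem h₁ h₂ using 1; ext x; simp [mul_add]
  | smul a Φ _ h => convert Submodule.smul_mem _ a h using 1; ext x; simp

/-- Swapping two neighbours costs a commutator, which expands into words with one letter fewer and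
the same degrees. The new letter carries the sum of the two arguments, which is why `Λ` has to be
closed under addition. -/
theorem word_perm_sub_mem (hg : HasGradedBracket F g deg) (hE : IsSubstClosed E Λ)
    {l l' : List (K × (X → Fin n → ℤ))} (h : l.Perm l') (hl : ∀ p ∈ l, p.2 ∈ Λ) :
    word F g l - word F g l' ∈
      shortWords g deg E Λ l.length (wordDeg deg l) (wordShift l) := by
  induction h with
  | nil => simp
  | cons p h ih =>
    have := ι_mul_mem_shortWords (p := p) (hl p (by simp))
      (ih fun q hq => hl q (List.mem_cons_of_mem _ hq))
    simp only [List.length_cons, wordDeg_cons, wordShift_cons]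
    convert this using 1
    ext x
    simp [mul_sub]
  | swap p q l =>
    obtain ⟨f, hf, hpq⟩ := hg q.1 p.1
    have hp := hl p (by simp)
    have hq := hl q (by simp)
    have key : word F g (q :: p :: l) - word F g (p :: q :: l) =
        ∑ s ∈ f.support, fun x => (f s).eval (q.2 x) (p.2 x) • word F g ((s, q.2 + p.2) :: l) x := by
      ext x
      have h1 : UniversalEnvelopingAlgebra.ι F (g q.1 (q.2 x)) *
          UniversalEnvelopingAlgebra.ι F (g p.1 (p.2 x)) -
          UniversalEnvelopingAlgebra.ι F (g p.1 (p.2 x)) *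
          UniversalEnvelopingAlgebra.ι F (g q.1 (q.2 x)) =
          UniversalEnvelopingAlgebra.ι F ⁅g q.1 (q.2 x), g p.1 (p.2 x)⁆ := by
        rw [LieHom.map_lie, LieRing.of_associative_ring_bracket]
      rw [Finset.sum_apply]
      simp only [Pi.sub_apply, word_cons, ← mul_assoc, ← sub_mul]
      rw [h1, hpq, Finsupp.sum, map_sum, Finset.sum_mul]
      simp
    rw [key]
    refine Submodule.sum_mem _ fun s hs => Submodule.subset_span
      ⟨_, hE (f s) _ hq _ hp, (s, q.2 + p.2) :: l, by simp, ?_, ?_, ?_, rfl⟩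
    · intro r hr
      rcases List.mem_cons.1 hr with rfl | hr
      · exact add_mem hq hp
      · exact hl r (by simp [hr])
    · simp [hf s hs, add_assoc]
    · simp [add_assoc]
  | trans h₁ h₂ ih₁ ih₂ =>
    have h := ih₂ fun p hp => hl p (h₁.mem_iff.2 hp)
    rw [← h₁.length_eq, ← wordDeg_perm deg h₁, ← wordShift_perm h₁] at h
    simpa using add_mem (ih₁ hl) h

end Words

/-! ### Normal forms in an induced module -/

section NormalForm

variable {F G : Type*} [Field F] [LieRing G] [LieAlgebra F G]
  {V : Type*} [AddCommGroup V] [Module F V] {P : LieSubalgebra F G}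
  (ρ : P →ₗ⁅F⁆ Module.End F V)

/-- `Ind.mk` as a bilinear map. -/
def Ind.mkₗ : UniversalEnvelopingAlgebra F G →ₗ[F] V →ₗ[F] Ind ρ :=
  (TensorProduct.mk F (UniversalEnvelopingAlgebra F G) V).compr₂
    ((indRel ρ).mkQ.restrictScalars F)

lemma Ind.mkₗ_apply (u : UniversalEnvelopingAlgebra F G) (y : V) :
    Ind.mkₗ ρ u y = Ind.mk ρ u y := rfl

lemma Ind.smul_mk (u u' : UniversalEnvelopingAlgebra F G) (y : V) :
    u • Ind.mk ρ u' y = Ind.mk ρ (u * u') y := by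
  rw [Ind.mk, ← map_smul, TensorProduct.smul_tmul', smul_eq_mul, Ind.mk]

lemma Ind.mk_mul_ι (u : UniversalEnvelopingAlgebra F G) (x : P) (y : V) :
    Ind.mk ρ (u * UniversalEnvelopingAlgebra.ι F (x : G)) y = Ind.mk ρ u (ρ x y) := by
  rw [← sub_eq_zero, Ind.mk, Ind.mk, ← map_sub, Submodule.mkQ_apply, Submodule.Quotient.mk_eq_zero]
  exact Submodule.subset_span ⟨u, x, y, rfl⟩

lemma Ind.induction {p : Ind ρ → Prop} (hadd : ∀ a b, p a → p b → p (a + b)) (h0 : p 0)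
    (hmk : ∀ u y, p (Ind.mk ρ u y)) (m : Ind ρ) : p m := by
  obtain ⟨t, rfl⟩ := Submodule.mkQ_surjective _ m
  induction t using TensorProduct.induction_on with
  | zero => simpa using h0
  | tmul u y => exact hmk u y
  | add a b ha hb => rw [map_add]; exact hadd _ _ ha hb

variable {n : ℕ} {K J X : Type*}

/-- The `g_k(α)` of positive degree kill `1 ⊗ V`, and those of degree zero act by exp-polynomial
functions. -/
structure HasHighestWeightAction (g : K → (Fin n → ℤ) → G) (deg : K → ℤ)
    (v : J × (Fin n → ℤ) → V) : Prop where
  pos : ∀ k, 0 < deg k → ∀ u α y,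
    Ind.mk ρ (u * UniversalEnvelopingAlgebra.ι F (g k α)) y = 0
  zero : ∀ k, deg k = 0 → ∀ j, ∃ h : J →₀ ExpPoly₂ F n, ∀ u α β,
    Ind.mk ρ (u * UniversalEnvelopingAlgebra.ι F (g k α)) (v (j, β)) =
      h.sum fun s c => c.eval α β • Ind.mk ρ u (v (s, α + β))

/-- The span, with coefficients in `E`, of the elements `w ⊗ v_j(B)` of given degrees, where `w`
is a word in the `g_k(α)` with negative `ℤ`-degree. -/
def normalForms (g : K → (Fin n → ℤ) → G) (deg : K → ℤ) (v : J × (Fin n → ℤ) → V)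
    (E : Subalgebra F (X → F)) (Λ : AddSubmonoid (X → Fin n → ℤ)) (d : ℤ) (L : X → Fin n → ℤ) :
    Submodule F (X → Ind ρ) :=
  Submodule.span F {Φ | ∃ c ∈ E, ∃ l : List (K × (X → Fin n → ℤ)), ∃ j : J, ∃ B ∈ Λ,
    (∀ p ∈ l, p.2 ∈ Λ) ∧ (∀ p ∈ l, deg p.1 < 0) ∧ wordDeg deg l = d ∧ wordShift l + B = L ∧
    Φ = fun x => c x • Ind.mk ρ (word F g l x) (v (j, B x))}

variable {ρ} {g : K → (Fin n → ℤ) → G} {deg : K → ℤ} {v : J × (Fin n → ℤ) → V}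
  {E : Subalgebra F (X → F)} {Λ : AddSubmonoid (X → Fin n → ℤ)}

lemma smul_mem_normalForms {d : ℤ} {L : X → Fin n → ℤ} {c : X → F} (hc : c ∈ E) {Φ : X → Ind ρ}
    (hΦ : Φ ∈ normalForms ρ g deg v E Λ d L) :
    (fun x => c x • Φ x) ∈ normalForms ρ g deg v E Λ d L := by
  induction hΦ using Submodule.span_induction with
  | mem Φ h =>
    obtain ⟨c', hc', l, j, B, hB, hl, hn, hd, hL, rfl⟩ := h
    exact Submodule.subset_span ⟨c * c', mul_mem hc hc', l, j, B, hB, hl, hn, hd, hL,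
      by ext x; simp [mul_smul]⟩
  | zero => convert Submodule.zero_mem (normalForms ρ g deg v E Λ d L) using 1; ext x; simp
  | add Φ Ψ _ _ h₁ h₂ => convert add_mem h₁ h₂ using 1; ext x; simp [smul_add]
  | smul a Φ _ h => convert Submodule.smul_mem _ a h using 1; ext x; simp [smul_comm _ a]

/-- Induction on length. A letter of nonnegative degree is moved to the right end modulo shorter
words, where it acts on `V` and disappears. The negative letters need not be ordered. All
coefficients come from substitution into structure functions, so they remain in `E`. -/
theorem mk_word_mem_normalForms (hg : HasGradedBracket F g deg) (hE : IsSubstClosed E Λ)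
    (hv : HasHighestWeightAction ρ g deg v) (N : ℕ) : ∀ l : List (K × (X → Fin n → ℤ)),
    l.length = N → (∀ p ∈ l, p.2 ∈ Λ) → ∀ (j : J), ∀ B ∈ Λ,
    (fun x => Ind.mk ρ (word F g l x) (v (j, B x))) ∈
      normalForms ρ g deg v E Λ (wordDeg deg l) (wordShift l + B) := by
  induction N using Nat.strong_induction_on with
  | _ N ih =>
  intro l hlN hl j B hB
  by_cases hneg : ∀ p ∈ l, deg p.1 < 0
  · exact Submodule.subset_span ⟨1, one_mem _, l, j, B, hB, hl, hneg, rfl, rfl, by simp⟩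
  push Not at hneg
  obtain ⟨p, hpl, hp⟩ := hneg
  obtain ⟨s, t, rfl⟩ := List.append_of_mem hpl
  have hperm : (s ++ p :: t).Perm ((s ++ t) ++ [p]) :=
    List.perm_middle.trans (List.perm_append_singleton p (s ++ t)).symm
  have hshort : ∀ Ψ ∈ shortWords g deg E Λ (s ++ p :: t).length (wordDeg deg (s ++ p :: t))
      (wordShift (s ++ p :: t)), (fun x => Ind.mk ρ (Ψ x) (v (j, B x))) ∈
      normalForms ρ g deg v E Λ (wordDeg deg (s ++ p :: t)) (wordShift (s ++ p :: t) + B) := by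
    intro Ψ hΨ
    induction hΨ using Submodule.span_induction with
    | mem Ψ h =>
      obtain ⟨c, hc, l', hl', hΛ, hd, hL, rfl⟩ := h
      have := smul_mem_normalForms hc (ih _ (hlN ▸ hl') l' rfl hΛ j B hB)
      rw [hd, hL] at this
      simpa [← Ind.mkₗ_apply] using this
    | zero =>
      convert Submodule.zero_mem (normalForms ρ g deg v E Λ _ _) using 1
      ext x
      simp [← Ind.mkₗ_apply]
    | add Φ Ψ _ _ h₁ h₂ => convert add_mem h₁ h₂ using 1; ext x; simp [← Ind.mkₗ_apply]
    | smul a Φ _ h => convert Submodule.smul_mem _ a h using 1; ext x; simp [← Ind.mkₗ_apply]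
  have h₁ := hshort _ (word_perm_sub_mem hg hE hperm hl)
  suffices h₂ : (fun x => Ind.mk ρ (word F g ((s ++ t) ++ [p]) x) (v (j, B x))) ∈
      normalForms ρ g deg v E Λ (wordDeg deg (s ++ p :: t)) (wordShift (s ++ p :: t) + B) by
    have := add_mem h₁ h₂
    convert this using 1
    ext x
    simp [← Ind.mkₗ_apply]
  -- Next to `v`, a letter of positive degree gives zero; one of degree zero is absorbed, its
  -- argument being added to `B`.
  rcases hp.lt_or_eq with hp | hp
  · convert Submodule.zero_mem _ using 1
    ext x
    simpa [mul_assoc] using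
      hv.pos p.1 hp (word F g (s ++ t) x) (p.2 x) (v (j, B x))
  · obtain ⟨h, hh⟩ := hv.zero p.1 hp.symm j
    have hpΛ := hl p hpl
    have key : (fun x => Ind.mk ρ (word F g ((s ++ t) ++ [p]) x) (v (j, B x))) =
        ∑ i ∈ h.support, fun x => (h i).eval (p.2 x) (B x) •
          Ind.mk ρ (word F g (s ++ t) x) (v (i, (p.2 + B) x)) := by
      ext x
      rw [Finset.sum_apply]
      simpa [Finsupp.sum, mul_assoc] using hh (word F g (s ++ t) x) (p.2 x) (B x)
    rw [key]
    refine Submodule.sum_mem _ fun i _ => smul_mem_normalForms (hE _ _ hpΛ _ hB) ?_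
    have := ih (s ++ t).length (by simp [← hlN]) (s ++ t) rfl
      (fun q hq => hl q (by simp at hq ⊢; tauto)) i (p.2 + B) (add_mem hpΛ hB)
    have e₁ : wordDeg deg (s ++ t) = wordDeg deg (s ++ p :: t) := by simp [← hp]
    have e₂ : wordShift (s ++ t) + (p.2 + B) = wordShift (s ++ p :: t) + B := by
      simp only [wordShift_append, wordShift_cons]; abel
    rwa [e₁, e₂] at this

end NormalForm

/-! ### A character of `ℤ × ℤⁿ` with pairwise distinct values -/

section Character

lemma padicValRat_prod_zpow {ι : Type*} {p : ι → ℕ} (hp : ∀ i, (p i).Prime)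
    (hinj : Function.Injective p) (z : ι → ℤ) (s : Finset ι) (j : ι) [DecidableEq ι] :
    padicValRat (p j) (∏ i ∈ s, (p i : ℚ) ^ z i) = if j ∈ s then z j else 0 := by
  have : Fact (p j).Prime := ⟨hp j⟩
  have h0 : ∀ i, (p i : ℚ) ≠ 0 := fun i => by exact_mod_cast (hp i).ne_zero
  induction s using Finset.induction_on with
  | empty => simp
  | insert i s hi ih =>
    rw [Finset.prod_insert hi, padicValRat.mul (zpow_ne_zero _ (h0 i))
      (Finset.prod_ne_zero_iff.2 fun k _ => zpow_ne_zero _ (h0 k)), ih, padicValRat.zpow]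
    by_cases hij : i = j
    · subst hij
      simp [hi, padicValRat.self (hp i).one_lt]
    · have : ¬ p j ∣ p i := fun h =>
        hij (hinj ((Nat.prime_dvd_prime_iff_eq (hp j) (hp i)).1 h)).symm
      simp [padicValRat.of_nat, padicValNat.eq_zero_of_not_dvd this, Ne.symm hij]

/-- Unique factorization: assign a different prime to each coordinate and read the exponents off
from the valuations. Characteristic zero embeds `ℚ` in `F`. -/
theorem exists_injective_character (F : Type*) [Field F] [CharZero F] (n : ℕ) :
    ∃ (a : ℤ → F) (b : (Fin n → ℤ) → F), a 0 = 1 ∧ b 0 = 1 ∧ (∀ x y, a (x + y) = a x * a y) ∧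
      (∀ x y, b (x + y) = b x * b y) ∧
      Function.Injective fun γ : ℤ × (Fin n → ℤ) => a γ.1 * b γ.2 := by
  let p : ℕ → ℕ := fun i => Nat.nth Nat.Prime i
  have hp : ∀ i, (p i).Prime := fun i => Nat.prime_nth_prime i
  have hinj : Function.Injective p := Nat.nth_injective Nat.infinite_setOfPred_prime
  have h0 : ∀ i, (p i : F) ≠ 0 := fun i => by exact_mod_cast (hp i).ne_zero
  refine ⟨fun x => (p 0 : F) ^ x, fun x => ∏ i : Fin n, (p (i + 1) : F) ^ x i, by simp, by simp,
    fun x y => zpow_add₀ (h0 _) _ _, fun x y => ?_, ?_⟩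
  · simp [zpow_add₀ (h0 _), Finset.prod_mul_distrib]
  · intro γ δ h
    let z : ℤ × (Fin n → ℤ) → Fin (n + 1) → ℤ := fun γ => Fin.cons γ.1 γ.2
    have hz : ∀ γ : ℤ × (Fin n → ℤ), (p 0 : F) ^ γ.1 * ∏ i : Fin n, (p (i + 1) : F) ^ γ.2 i =
        ((∏ i : Fin (n + 1), (p i : ℚ) ^ z γ i : ℚ) : F) := by
      intro γ
      rw [Fin.prod_univ_succ]
      simp [z]
    simp only [hz, Rat.cast_inj] at h
    have hq : z γ = z δ := by
      funext j
      have := congrArg (padicValRat (p j)) h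
      have hpi : Function.Injective fun i : Fin (n + 1) => p i := hinj.comp Fin.val_injective
      rw [padicValRat_prod_zpow (p := fun i : Fin (n + 1) => p i) (fun i => hp i) hpi,
        padicValRat_prod_zpow (p := fun i : Fin (n + 1) => p i) (fun i => hp i) hpi] at this
      simpa using this
    obtain ⟨h₁, h₂⟩ := Fin.cons_inj.1 hq
    exact Prod.ext h₁ h₂

end Character

/-! ### Projections and scalings of graded Lie algebras -/

section Grading

variable {F G Γ : Type*} [Field F] [LieRing G] [LieAlgebra F G] [AddCommMonoid Γ] [DecidableEq Γ]
  (𝒜 : Γ → Submodule F G) [GradedLieAlgebra 𝒜]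

/-- The projection of `G = ⨁ 𝒜 γ` onto the component `𝒜 γ`. -/
def gradedProj (γ : Γ) : G →ₗ[F] G :=
  (𝒜 γ).subtype ∘ₗ (DirectSum.component F Γ (fun i => 𝒜 i) γ) ∘ₗ
    (DirectSum.decomposeLinearEquiv 𝒜).toLinearMap

lemma gradedProj_of_mem {γ : Γ} {x : G} (hx : x ∈ 𝒜 γ) : gradedProj 𝒜 γ x = x :=
  DirectSum.decompose_of_mem_same 𝒜 hx

lemma gradedProj_of_mem_ne {γ δ : Γ} {x : G} (hx : x ∈ 𝒜 δ) (h : δ ≠ γ) :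
    gradedProj 𝒜 γ x = 0 :=
  DirectSum.decompose_of_mem_ne 𝒜 hx h

theorem exists_scaling (χ : Γ → F) (hχ : ∀ x y, χ (x + y) = χ x * χ y) :
    ∃ σ : G →ₗ⁅F⁆ G, ∀ γ, ∀ x ∈ 𝒜 γ, σ x = χ γ • x := by
  let σ : G →ₗ[F] G := (DirectSum.toModule F Γ G fun γ => χ γ • (𝒜 γ).subtype) ∘ₗ
    (DirectSum.decomposeLinearEquiv 𝒜).toLinearMap
  have hσ : ∀ γ, ∀ x ∈ 𝒜 γ, σ x = χ γ • x := by
    intro γ x hx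
    simp only [σ, LinearMap.comp_apply, LinearEquiv.coe_coe, DirectSum.decomposeLinearEquiv_apply]
    rw [DirectSum.decompose_of_mem 𝒜 hx]
    exact DirectSum.toModule_lof (M := fun i => 𝒜 i)
      (φ := fun γ => χ γ • (𝒜 γ).subtype) F γ (⟨x, hx⟩ : 𝒜 γ)
  refine ⟨{ σ with map_lie' := fun {x y} => ?_ }, hσ⟩
  change σ ⁅x, y⁆ = ⁅σ x, σ y⁆
  induction x using DirectSum.Decomposition.inductionOn 𝒜 with
  | zero => simp
  | homogeneous x =>
    induction y using DirectSum.Decomposition.inductionOn 𝒜 with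
    | zero => simp
    | homogeneous y =>
      rw [hσ _ _ x.2, hσ _ _ y.2, hσ _ _ (SetLike.GradedBracket.bracket_mem x.2 y.2), hχ]
      rw [smul_lie, lie_smul, mul_smul]
    | add y z hy hz => simp [hy, hz]
  | add x z hx hz => simp [hx, hz]

end Grading

/-! ### Scalings of induced modules -/

section IndMap

variable {F G : Type*} [Field F] [LieRing G] [LieAlgebra F G]
  {V : Type*} [AddCommGroup V] [Module F V] {P : LieSubalgebra F G}
  {ρ : P →ₗ⁅F⁆ Module.End F V}

/-- Functoriality of induction in a compatible pair (`σ`, `τ`). The resulting map is only semilinear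
over the endomorphism of `U(G)` extending `σ`, which is enough to preserve the `U(G)`-submodule of
relations. -/
theorem Ind.exists_map (σ : G →ₗ⁅F⁆ G) (τ : V →ₗ[F] V) (hP : ∀ x ∈ P, σ x ∈ P)
    (hρ : ∀ (x : P) (y : V), ρ ⟨σ x, hP x x.2⟩ (τ y) = τ (ρ x y)) :
    ∃ T : Ind ρ →ₗ[F] Ind ρ, ∀ u y, T (Ind.mk ρ u y) =
      Ind.mk ρ (UniversalEnvelopingAlgebra.lift F
        ((UniversalEnvelopingAlgebra.ι F).comp σ) u) (τ y) := by
  set φ := UniversalEnvelopingAlgebra.lift F ((UniversalEnvelopingAlgebra.ι F).comp σ) with hφ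
  let S : UniversalEnvelopingAlgebra F G ⊗[F] V →ₗ[F] UniversalEnvelopingAlgebra F G ⊗[F] V :=
    TensorProduct.map φ.toLinearMap τ
  have hS : ∀ u t, S (u • t) = φ u • S t := by
    intro u t
    induction t using TensorProduct.induction_on with
    | zero => simp
    | tmul u' y => simp [S, TensorProduct.smul_tmul']
    | add a b ha hb => simp [ha, hb]
  have hker : (indRel ρ).restrictScalars F ≤
      LinearMap.ker (((indRel ρ).mkQ.restrictScalars F) ∘ₗ S) := by
    intro t ht
    rw [Submodule.restrictScalars_mem] at ht
    suffices S t ∈ indRel ρ by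
      simpa [Submodule.Quotient.mk_eq_zero] using this
    induction ht using Submodule.span_induction with
    | mem t h =>
      obtain ⟨u, x, y, rfl⟩ := h
      refine Submodule.subset_span ⟨φ u, ⟨σ x, hP x x.2⟩, τ y, ?_⟩
      rw [hρ]
      simp [S, hφ]
    | zero => simp
    | add a b _ _ ha hb => rw [map_add]; exact add_mem ha hb
    | smul u t _ h => rw [hS]; exact Submodule.smul_mem _ _ h
  exact ⟨((indRel ρ).restrictScalars F).liftQ _ hker ∘ₗ
    (Submodule.Quotient.restrictScalarsEquiv F (indRel ρ)).symm.toLinearMap, fun u y => rfl⟩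

end IndMap

/-! ### The grading of `M̃(V)` -/

section Extragraded

variable {F G : Type*} [Field F] [LieRing G] [LieAlgebra F G] {n : ℕ}
  {𝒜 : (Fin n → ℤ) → Submodule F G} [GradedLieAlgebra 𝒜]
  {ℬ : ℤ → Submodule F G} [GradedLieAlgebra ℬ]
  {K : Type*} {g : K → (Fin n → ℤ) → G} {deg : K → ℤ}

lemma IsExtragraded.mem_bigrading (hG : IsExtragraded 𝒜 ℬ g deg) (k : K) (α : Fin n → ℤ) :
    g k α ∈ bigrading 𝒜 ℬ (deg k, α) :=
  ⟨hG.mem k α, hG.isExpPolynomialLie.mem k α⟩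

/-- Expand an element of `G⁽ⁱ⁾` in the `g_k(β)` with `deg k = i` and project to `G_α`: only the
terms with `β = α` survive. -/
lemma IsExtragraded.bigrading_le_span (hG : IsExtragraded 𝒜 ℬ g deg) (γ : ℤ × (Fin n → ℤ)) :
    bigrading 𝒜 ℬ γ ≤ Submodule.span F {x | ∃ k, deg k = γ.1 ∧ x = g k γ.2} := by
  rintro x ⟨hx, hx'⟩
  have hx : x ∈ ℬ γ.1 := hx
  rw [← hG.span_eq γ.1] at hx
  have h := Submodule.mem_map_of_mem (f := gradedProj 𝒜 γ.2) hx
  rw [gradedProj_of_mem 𝒜 hx', Submodule.map_span] at h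
  refine Submodule.span_le.2 ?_ h
  rintro _ ⟨_, ⟨k, α, hk, rfl⟩, rfl⟩
  by_cases hα : α = γ.2
  · subst hα
    rw [gradedProj_of_mem 𝒜 (hG.isExpPolynomialLie.mem k _)]
    exact Submodule.subset_span ⟨k, hk, rfl⟩
  · rw [gradedProj_of_mem_ne 𝒜 (hG.isExpPolynomialLie.mem k _) hα]
    exact Submodule.zero_mem _

/-- The given structure functions may involve indices of the wrong degree, since the `g_k(α)` need
not be independent. Projecting the bracket relation to the right `ℤ`-degree shows that these terms
can be dropped. -/
lemma IsExtragraded.hasGradedBracket (hG : IsExtragraded 𝒜 ℬ g deg) :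
    HasGradedBracket F g deg := by
  classical
  intro k r
  obtain ⟨f, hf⟩ := hG.isExpPolynomialLie.exists_structure
  refine ⟨(f k r).filter fun s => deg s = deg k + deg r, fun s hs => ?_, fun α β => ?_⟩
  · rw [Finsupp.support_filter, Finset.mem_filter] at hs
    exact hs.2
  · have h := congrArg (gradedProj ℬ (deg k + deg r)) (hf k r α β)
    rw [gradedProj_of_mem ℬ (SetLike.GradedBracket.bracket_mem (hG.mem k α) (hG.mem r β))] at h
    rw [h, Finsupp.sum, map_sum, Finsupp.sum, Finsupp.support_filter, Finset.sum_filter]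
    refine Finset.sum_congr rfl fun s _ => ?_
    rw [map_smul]
    split_ifs with hs
    · rw [gradedProj_of_mem ℬ (hs ▸ hG.mem s _),
        Finsupp.filter_apply_pos (fun s => deg s = deg k + deg r) _ hs]
    · rw [gradedProj_of_mem_ne ℬ (hG.mem s _) hs, smul_zero]

variable {V : Type*} [AddCommGroup V] [Module F V]
  [LieRingModule (zeroPart ℬ) V] [LieModule F (zeroPart ℬ) V]
  {J : Type*} {v : Module.Basis (J × (Fin n → ℤ)) F V}

lemma IsExtragraded.hasHighestWeightAction (hG : IsExtragraded 𝒜 ℬ g deg)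
    (hV : IsExpPolynomialModule (zeroSpanningSet ℬ hG.mem) v) :
    HasHighestWeightAction (inflate ℬ V) g deg v where
  pos k hk u α y := by
    have hx : g k α ∈ ⨆ i : {i : ℤ // 1 ≤ i}, ℬ i :=
      Submodule.mem_iSup_of_mem (p := fun i : {i : ℤ // 1 ≤ i} => ℬ i) ⟨deg k, hk⟩ (hG.mem k α)
    have h := Ind.mk_mul_ι (inflate ℬ V) u ⟨g k α, Submodule.mem_sup_right hx⟩ y
    rw [inflate_apply_pos ℬ _ hx] at h
    rw [h, ← Ind.mkₗ_apply, map_zero]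
  zero k hk j := by
    obtain ⟨h, hh⟩ := hV
    refine ⟨h ⟨k, hk⟩ j, fun u α β => ?_⟩
    have hx : g k α ∈ ℬ 0 := hk ▸ hG.mem k α
    have h₁ := Ind.mk_mul_ι (inflate ℬ V) u ⟨g k α, Submodule.mem_sup_left hx⟩ (v (j, β))
    rw [inflate_apply_zero ℬ _ hx] at h₁
    refine h₁.trans ?_
    have h₂ := hh ⟨k, hk⟩ j α β
    simp only [zeroSpanningSet] at h₂
    rw [h₂, Finsupp.sum, ← Ind.mkₗ_apply, map_sum]
    simp [Finsupp.sum, Ind.mkₗ_apply]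

/-! ### Homogeneous components and words -/

lemma IsMonomial.append {Γ : Type*} [AddMonoid Γ] {𝒢 : Γ → Submodule F G} {γ δ : Γ}
    {u w : UniversalEnvelopingAlgebra F G} (hu : IsMonomial 𝒢 γ u) (hw : IsMonomial 𝒢 δ w) :
    IsMonomial 𝒢 (γ + δ) (u * w) := by
  induction hu with
  | one => simpa using hw
  | mul hx _ ih => rw [mul_assoc, add_assoc]; exact .mul hx ih

variable {X : Type*}

lemma IsExtragraded.isMonomial_word (hG : IsExtragraded 𝒜 ℬ g deg)
    (l : List (K × (X → Fin n → ℤ))) (x : X) :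
    IsMonomial (bigrading 𝒜 ℬ) (wordDeg deg l, wordShift l x) (word F g l x) := by
  induction l with
  | nil => exact .one
  | cons p l ih =>
    have := IsMonomial.mul (hG.mem_bigrading p.1 (p.2 x)) ih
    simpa using this

lemma IsExtragraded.isMonomial_mem_span (hG : IsExtragraded 𝒜 ℬ g deg)
    {γ : ℤ × (Fin n → ℤ)} {u : UniversalEnvelopingAlgebra F G}
    (hu : IsMonomial (bigrading 𝒜 ℬ) γ u) :
    u ∈ Submodule.span F {w | ∃ l : List (K × (Unit → Fin n → ℤ)), wordDeg deg l = γ.1 ∧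
      wordShift l () = γ.2 ∧ w = word F g l ()} := by
  induction hu with
  | one => exact Submodule.subset_span ⟨[], rfl, rfl, rfl⟩
  | @mul γ δ x u hx' hu ih =>
    have hx := hG.bigrading_le_span γ hx'
    clear hu hx'
    induction hx using Submodule.span_induction with
    | mem x h =>
      obtain ⟨k, hk, rfl⟩ := h
      induction ih using Submodule.span_induction with
      | mem u h =>
        obtain ⟨l, hd, hL, rfl⟩ := h
        exact Submodule.subset_span ⟨(k, fun _ => γ.2) :: l, by simp [hk, hd], by simp [hL],
          by simp⟩
      | zero => simp
      | add a b _ _ ha hb => rw [mul_add]; exact add_mem ha hb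
      | smul c a _ ha => rw [mul_smul_comm]; exact Submodule.smul_mem _ _ ha
    | zero => simp
    | add a b _ _ ha hb => rw [map_add, add_mul]; exact add_mem ha hb
    | smul c a _ ha => rw [map_smul, smul_mul_assoc]; exact Submodule.smul_mem _ _ ha

/-- The span of the words is a subalgebra containing the image of `G`. By the universal property the
identity of `U(G)` factors through it. -/
lemma IsExtragraded.span_word (hG : IsExtragraded 𝒜 ℬ g deg) :
    Submodule.span F (Set.range fun l : List (K × (Unit → Fin n → ℤ)) => word F g l ()) = ⊤ := by
  set W := Submodule.span F (Set.range fun l : List (K × (Unit → Fin n → ℤ)) => word F g l ())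
    with hW
  have hmul : ∀ a b, a ∈ W → b ∈ W → a * b ∈ W := by
    intro a b ha hb
    have h : W * W ≤ W := by
      rw [hW, Submodule.span_mul_span, Submodule.span_le]
      rintro _ ⟨_, ⟨l, rfl⟩, _, ⟨l', rfl⟩, rfl⟩
      exact Submodule.subset_span ⟨l ++ l', by simp⟩
    exact h (Submodule.mul_mem_mul ha hb)
  have hι : ∀ x, UniversalEnvelopingAlgebra.ι F x ∈ W := by
    intro x
    have hx : x ∈ Submodule.span F {x | ∃ k α, x = g k α} := by
      rw [hG.isExpPolynomialLie.span_eq_top]; trivial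
    induction hx using Submodule.span_induction with
    | mem x h =>
      obtain ⟨k, α, rfl⟩ := h
      exact Submodule.subset_span ⟨[(k, fun _ => α)], mul_one _⟩
    | zero => rw [map_zero]; exact Submodule.zero_mem _
    | add a b _ _ ha hb => rw [map_add]; exact add_mem ha hb
    | smul c a _ ha => rw [map_smul]; exact Submodule.smul_mem _ _ ha
  let A : Subalgebra F (UniversalEnvelopingAlgebra F G) :=
    W.toSubalgebra (Submodule.subset_span ⟨[], rfl⟩) hmul
  let f : G →ₗ⁅F⁆ A :=
    { toFun := fun x => ⟨UniversalEnvelopingAlgebra.ι F x, hι x⟩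
      map_add' := fun x y => Subtype.ext (map_add _ x y)
      map_smul' := fun c x => Subtype.ext (map_smul _ c x)
      map_lie' := fun {x y} => Subtype.ext (LieHom.map_lie _ x y) }
  have hf : A.val.comp (UniversalEnvelopingAlgebra.lift F f) = AlgHom.id F _ := by
    ext x
    change ((UniversalEnvelopingAlgebra.lift F f (UniversalEnvelopingAlgebra.ι F x) : A) : _) =
      UniversalEnvelopingAlgebra.ι F x
    rw [UniversalEnvelopingAlgebra.lift_ι_apply]
    rfl
  refine eq_top_iff.2 fun u _ => ?_
  have hu := DFunLike.congr_fun hf u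
  rw [AlgHom.id_apply] at hu
  rw [← hu]
  exact (UniversalEnvelopingAlgebra.lift F f u).2

variable (v) in
/-- The component of degree `γ` is spanned by the `w ⊗ v_j(β)`, `w` a word of the appropriate
degree. -/
lemma IsExtragraded.component_le_span (hG : IsExtragraded 𝒜 ℬ g deg) (γ : ℤ × (Fin n → ℤ)) :
    MTilde.component 𝒜 ℬ (moduleComponent v) γ ≤
      Submodule.span F {m | ∃ (l : List (K × (Unit → Fin n → ℤ))) (j : J) (β : Fin n → ℤ),
        wordDeg deg l = γ.1 ∧ wordShift l () + β = γ.2 ∧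
        m = Ind.mk (inflate ℬ V) (word F g l ()) (v (j, β))} := by
  refine Submodule.span_le.2 ?_
  rintro _ ⟨δ, ε, u, y, rfl, hu, hy, rfl⟩
  rw [bigradingModule] at hy
  split_ifs at hy with hε
  · replace hu := hG.isMonomial_mem_span hu
    rw [SetLike.mem_coe, ← Ind.mkₗ_apply]
    induction hu using Submodule.span_induction with
    | mem u h =>
      obtain ⟨l, hd, hL, rfl⟩ := h
      induction hy using Submodule.span_induction with
      | mem y h =>
        obtain ⟨j, rfl⟩ := h
        exact Submodule.subset_span ⟨l, j, ε.2, by simp [hd, hε], by simp [hL], rfl⟩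
      | zero => simp
      | add a b _ _ ha hb => rw [map_add]; exact add_mem ha hb
      | smul c a _ ha => rw [map_smul]; exact Submodule.smul_mem _ _ ha
    | zero => simp
    | add a b _ _ ha hb => rw [map_add, LinearMap.add_apply]; exact add_mem ha hb
    | smul c a _ ha => rw [map_smul, LinearMap.smul_apply]; exact Submodule.smul_mem _ _ ha
  · rw [Submodule.mem_bot] at hy
    rw [hy, ← Ind.mkₗ_apply, map_zero]
    exact Submodule.zero_mem _

/-- In `component_le_span` words whose letters have negative `ℤ`-degree suffice. -/
theorem IsExtragraded.component_le_span_neg (hG : IsExtragraded 𝒜 ℬ g deg)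
    (hV : IsExpPolynomialModule (zeroSpanningSet ℬ hG.mem) v) (γ : ℤ × (Fin n → ℤ)) :
    MTilde.component 𝒜 ℬ (moduleComponent v) γ ≤
      Submodule.span F {m | ∃ (l : List (K × (Unit → Fin n → ℤ))) (j : J) (β : Fin n → ℤ),
        (∀ p ∈ l, deg p.1 < 0) ∧ wordDeg deg l = γ.1 ∧ wordShift l () + β = γ.2 ∧
        m = Ind.mk (inflate ℬ V) (word F g l ()) (v (j, β))} := by
  refine (hG.component_le_span v γ).trans (Submodule.span_le.2 ?_)
  rintro _ ⟨l, j, β, hd, hL, rfl⟩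
  have h := mk_word_mem_normalForms hG.hasGradedBracket (isSubstClosed_top (X := Unit))
    (hG.hasHighestWeightAction hV) _ l rfl (fun _ _ => trivial) j (fun _ => β) trivial
  rw [hd] at h
  have hL' : (wordShift l + fun _ => β) = fun _ => γ.2 := funext fun _ => hL
  rw [hL'] at h
  have key : ∀ Φ ∈ normalForms (inflate ℬ V) g deg v (⊤ : Subalgebra F (Unit → F)) ⊤ γ.1
      (fun _ => γ.2), Φ () ∈ Submodule.span F {m | ∃ (l : List (K × (Unit → Fin n → ℤ))) (j : J)
        (β : Fin n → ℤ), (∀ p ∈ l, deg p.1 < 0) ∧ wordDeg deg l = γ.1 ∧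
        wordShift l () + β = γ.2 ∧ m = Ind.mk (inflate ℬ V) (word F g l ()) (v (j, β))} := by
    intro Φ hΦ
    induction hΦ using Submodule.span_induction with
    | mem Φ h =>
      obtain ⟨c, -, l', j', B, -, -, hn, hd', hB, rfl⟩ := h
      exact Submodule.smul_mem _ _
        (Submodule.subset_span ⟨l', j', B (), hn, hd', congrFun hB (), rfl⟩)
    | zero => exact Submodule.zero_mem _
    | add a b _ _ ha hb => exact add_mem ha hb
    | smul c a _ ha => exact Submodule.smul_mem _ _ ha
  exact key _ h

/-! ### Components of nonnegative `ℤ`-degree -/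

lemma wordDeg_nonpos {l : List (K × (X → Fin n → ℤ))} (hl : ∀ p ∈ l, deg p.1 < 0) :
    wordDeg deg l ≤ 0 ∧ (wordDeg deg l = 0 → l = []) := by
  induction l with
  | nil => simp
  | cons p l ih =>
    have h₁ := hl p (by simp)
    have h₂ := (ih fun q hq => hl q (by simp [hq])).1
    rw [wordDeg_cons]
    exact ⟨by omega, fun h => by omega⟩

lemma IsExtragraded.component_eq_bot (hG : IsExtragraded 𝒜 ℬ g deg)
    (hV : IsExpPolynomialModule (zeroSpanningSet ℬ hG.mem) v) {γ : ℤ × (Fin n → ℤ)}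
    (hγ : 0 < γ.1) : MTilde.component 𝒜 ℬ (moduleComponent v) γ = ⊥ := by
  refine eq_bot_iff.2 ((hG.component_le_span_neg hV γ).trans (Submodule.span_le.2 ?_))
  rintro _ ⟨l, j, β, hn, hd, -, rfl⟩
  have := (wordDeg_nonpos hn).1
  omega

lemma IsExtragraded.component_le_range (hG : IsExtragraded 𝒜 ℬ g deg)
    (hV : IsExpPolynomialModule (zeroSpanningSet ℬ hG.mem) v) {γ : ℤ × (Fin n → ℤ)}
    (hγ : γ.1 = 0) : MTilde.component 𝒜 ℬ (moduleComponent v) γ ≤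
      LinearMap.range (Ind.incl (inflate ℬ V)) := by
  refine (hG.component_le_span_neg hV γ).trans (Submodule.span_le.2 ?_)
  rintro _ ⟨l, j, β, hn, hd, -, rfl⟩
  rw [(wordDeg_nonpos hn).2 (hd.trans hγ)]
  exact ⟨v (j, β), rfl⟩

lemma IsExtragraded.mk_word_mem_component (hG : IsExtragraded 𝒜 ℬ g deg)
    (l : List (K × (X → Fin n → ℤ))) (x : X) (j : J) (β : Fin n → ℤ) :
    Ind.mk (inflate ℬ V) (word F g l x) (v (j, β)) ∈
      MTilde.component 𝒜 ℬ (moduleComponent v) (wordDeg deg l, wordShift l x + β) := by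
  refine Submodule.subset_span ⟨(wordDeg deg l, wordShift l x), (0, β), _, _, by simp,
    hG.isMonomial_word l x, ?_, rfl⟩
  rw [bigradingModule, if_pos rfl]
  exact Submodule.subset_span ⟨j, rfl⟩

lemma IsExtragraded.word_smul_mem_component (hG : IsExtragraded 𝒜 ℬ g deg)
    {𝒱 : (Fin n → ℤ) → Submodule F V} (l : List (K × (X → Fin n → ℤ))) (x : X)
    {γ : ℤ × (Fin n → ℤ)} {m : MTilde ℬ V} (hm : m ∈ MTilde.component 𝒜 ℬ 𝒱 γ) :
    word F g l x • m ∈ MTilde.component 𝒜 ℬ 𝒱 ((wordDeg deg l, wordShift l x) + γ) := by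
  induction hm using Submodule.span_induction with
  | mem m h =>
    obtain ⟨δ, ε, u, y, rfl, hu, hy, rfl⟩ := h
    rw [Ind.smul_mk]
    exact Submodule.subset_span ⟨_, ε, _, y, add_assoc _ _ _, (hG.isMonomial_word l x).append hu,
      hy, rfl⟩
  | zero => simp
  | add a b _ _ ha hb => rw [smul_add]; exact add_mem ha hb
  | smul c a _ ha => rw [smul_comm]; exact Submodule.smul_mem _ _ ha

end Extragraded

/-! ### The radical and the grading of the quotient -/

section Internal

/-- Eigenspaces for distinct eigenvalues are independent. -/
lemma iSupIndep_of_scaling {F M Γ : Type*} [Field F] [AddCommGroup M] [Module F M]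
    {ℳ : Γ → Submodule F M} {T : Module.End F M} {χ : Γ → F} (hχ : Function.Injective χ)
    (hT : ∀ γ, ∀ m ∈ ℳ γ, T m = χ γ • m) : iSupIndep ℳ :=
  (T.eigenspaces_iSupIndep.comp hχ).mono fun γ m hm => Module.End.mem_eigenspace_iff.2 (hT γ m hm)

end Internal

section Radical

variable {F G : Type*} [Field F] [LieRing G] [LieAlgebra F G] {n : ℕ}
  {𝒜 : (Fin n → ℤ) → Submodule F G} [GradedLieAlgebra 𝒜]
  {ℬ : ℤ → Submodule F G} [GradedLieAlgebra ℬ]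
  {K : Type*} {g : K → (Fin n → ℤ) → G} {deg : K → ℤ}
  {V : Type*} [AddCommGroup V] [Module F V]
  [LieRingModule (zeroPart ℬ) V] [LieModule F (zeroPart ℬ) V]
  {J : Type*} {v : Module.Basis (J × (Fin n → ℤ)) F V}

/-- With an injective character this operator separates the components of `M̃(V)`. It is induced by
the scalings of `G` and `V`, which are compatible because both actions add degrees. -/
theorem IsExtragraded.exists_scaling_MTilde (hG : IsExtragraded 𝒜 ℬ g deg)
    (hV : IsExpPolynomialModule (zeroSpanningSet ℬ hG.mem) v) {a : ℤ → F}
    {b : (Fin n → ℤ) → F} (ha0 : a 0 = 1) (hb0 : b 0 = 1) (ha : ∀ x y, a (x + y) = a x * a y)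
    (hb : ∀ x y, b (x + y) = b x * b y) :
    ∃ T : Module.End F (MTilde ℬ V), ∀ γ, ∀ m ∈ MTilde.component 𝒜 ℬ (moduleComponent v) γ,
      T m = (a γ.1 * b γ.2) • m := by
  obtain ⟨σ₁, hσ₁⟩ := exists_scaling ℬ a ha
  obtain ⟨σ₂, hσ₂⟩ := exists_scaling 𝒜 b hb
  let σ := σ₁.comp σ₂
  have hσ : ∀ γ, ∀ x ∈ bigrading 𝒜 ℬ γ, σ x = (a γ.1 * b γ.2) • x := by
    rintro γ x ⟨h₁, h₂⟩
    change σ₁ (σ₂ x) = _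
    rw [hσ₂ _ _ h₂, map_smul, hσ₁ _ _ h₁, smul_smul, mul_comm]
  have hσg : ∀ k α, σ (g k α) = (a (deg k) * b α) • g k α := fun k α =>
    hσ _ _ (hG.mem_bigrading k α)
  -- That each `G⁽ⁱ⁾` is stable under the `ℤⁿ`-scaling is seen on its spanning set of bihomogeneous
  -- elements.
  have hσB : ∀ i, ℬ i ≤ (ℬ i).comap (σ : G →ₗ[F] G) := by
    intro i
    conv_lhs => rw [← hG.span_eq i]
    refine Submodule.span_le.2 ?_
    rintro _ ⟨k, α, rfl, rfl⟩
    change σ (g k α) ∈ ℬ (deg k)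
    rw [hσg]
    exact Submodule.smul_mem _ _ (hG.mem k α)
  have hP : (nonnegPart ℬ).toSubmodule ≤ (nonnegPart ℬ).toSubmodule.comap (σ : G →ₗ[F] G) := by
    change ℬ 0 ⊔ (⨆ i : {i : ℤ // 1 ≤ i}, ℬ i) ≤
      (ℬ 0 ⊔ ⨆ i : {i : ℤ // 1 ≤ i}, ℬ i).comap (σ : G →ₗ[F] G)
    refine sup_le ((hσB 0).trans (Submodule.comap_mono le_sup_left)) (iSup_le fun i => ?_)
    exact (hσB i).trans (Submodule.comap_mono
      (le_sup_of_le_right (le_iSup (fun i : {i : ℤ // 1 ≤ i} => ℬ i) i)))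
  let τ : V →ₗ[F] V := v.constr F fun p => b p.2 • v p
  have hτ : ∀ p, τ (v p) = b p.2 • v p := fun p => v.constr_basis F _ p
  have hστ : ∀ x y, ⁅zeroComponent ℬ (σ x), τ y⁆ = τ ⁅zeroComponent ℬ x, y⁆ := by
    intro x y
    have hx : x ∈ Submodule.span F {x | ∃ k α, x = g k α} := by
      rw [hG.isExpPolynomialLie.span_eq_top]; trivial
    induction hx using Submodule.span_induction with
    | mem x h =>
      obtain ⟨k, α, rfl⟩ := h
      rw [hσg, map_smul]
      by_cases hk : deg k = 0
      · have hz : zeroComponent ℬ (g k α) = zeroSpanningSet ℬ hG.mem ⟨k, hk⟩ α :=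
          Subtype.ext (zeroComponent_of_mem ℬ (hk ▸ hG.mem k α))
        rw [hz, hk, ha0, one_mul]
        obtain ⟨h, hh⟩ := hV
        have hy : y ∈ Submodule.span F (Set.range v) := by rw [v.span_eq]; trivial
        induction hy using Submodule.span_induction with
        | mem y h' =>
          obtain ⟨⟨j, β⟩, rfl⟩ := h'
          rw [hτ, smul_lie, lie_smul, hh, Finsupp.sum, map_sum, Finset.smul_sum, Finset.smul_sum]
          refine Finset.sum_congr rfl fun s _ => ?_
          rw [map_smul, hτ, hb]
          simp only [smul_smul]
          ring_nf
        | zero => simp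
        | add y z _ _ hy hz => simp only [map_add, lie_add, hy, hz]
        | smul c y _ hy => simp only [map_smul, lie_smul, hy]
      · rw [zeroComponent_of_mem_ne ℬ (hG.mem k α) hk]
        simp
    | zero => simp
    | add x z _ _ hx hz => simp only [map_add, add_lie, hx, hz]
    | smul c x _ hx => simp only [map_smul, smul_lie, hx]
  obtain ⟨T, hT⟩ := Ind.exists_map (ρ := inflate ℬ V) σ τ hP fun x y => hστ x y
  refine ⟨T, fun γ m hm => ?_⟩
  induction hm using Submodule.span_induction with
  | mem m h =>
    obtain ⟨δ, ε, u, y, rfl, hu, hy, rfl⟩ := h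
    rw [hT]
    have h₁ : UniversalEnvelopingAlgebra.lift F ((UniversalEnvelopingAlgebra.ι F).comp σ) u =
        (a δ.1 * b δ.2) • u := by
      induction hu with
      | one => simp [ha0, hb0]
      | mul hx _ ih =>
        rw [map_mul, ih, UniversalEnvelopingAlgebra.lift_ι_apply, LieHom.comp_apply, hσ _ _ hx,
          map_smul, smul_mul_smul_comm, Prod.fst_add, Prod.snd_add, ha, hb]
        ring_nf
    have h₂ : τ y = (a ε.1 * b ε.2) • y := by
      rw [bigradingModule] at hy
      split_ifs at hy with hε
      · rw [hε, ha0, one_mul]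
        induction hy using Submodule.span_induction with
        | mem y h => obtain ⟨j, rfl⟩ := h; exact hτ _
        | zero => simp
        | add y z _ _ hy hz => rw [map_add, hy, hz, smul_add]
        | smul c y _ hy => rw [map_smul, hy, smul_comm]
      · rw [Submodule.mem_bot] at hy
        simp [hy]
    rw [h₁, h₂, ← Ind.mkₗ_apply, map_smul, map_smul, LinearMap.smul_apply, smul_smul,
      Ind.mkₗ_apply, Prod.fst_add, Prod.snd_add, ha, hb]
    ring_nf
  | zero => simp
  | add y z _ _ hy hz => rw [map_add, hy, hz, smul_add]
  | smul c y _ hy => rw [map_smul, hy, smul_comm]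

lemma IsExtragraded.iSup_component (hG : IsExtragraded 𝒜 ℬ g deg) :
    ⨆ γ, MTilde.component 𝒜 ℬ (moduleComponent v) γ = ⊤ := by
  refine (Submodule.eq_top_iff'.2 fun m => ?_)
  induction m using Ind.induction with
  | hadd a b ha hb => exact add_mem ha hb
  | h0 => exact Submodule.zero_mem _
  | hmk u y =>
    rw [← Ind.mkₗ_apply]
    have hu : u ∈ Submodule.span F
        (Set.range fun l : List (K × (Unit → Fin n → ℤ)) => word F g l ()) := by
      rw [hG.span_word]; trivial
    have hy : y ∈ Submodule.span F (Set.range v) := by rw [v.span_eq]; trivial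
    induction hu using Submodule.span_induction with
    | mem u h =>
      obtain ⟨l, rfl⟩ := h
      induction hy using Submodule.span_induction with
      | mem y h =>
        obtain ⟨⟨j, β⟩, rfl⟩ := h
        exact Submodule.mem_iSup_of_mem _ (hG.mk_word_mem_component l () j β)
      | zero => rw [map_zero]; exact Submodule.zero_mem _
      | add a b _ _ ha hb => rw [map_add]; exact add_mem ha hb
      | smul c a _ ha => rw [map_smul]; exact Submodule.smul_mem _ _ ha
    | zero => rw [map_zero]; exact Submodule.zero_mem _
    | add a b _ _ ha hb => rw [map_add, LinearMap.add_apply]; exact add_mem ha hb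
    | smul c a _ ha => rw [map_smul, LinearMap.smul_apply]; exact Submodule.smul_mem _ _ ha

lemma IsExtragraded.iSupIndep_component [CharZero F] (hG : IsExtragraded 𝒜 ℬ g deg)
    (hV : IsExpPolynomialModule (zeroSpanningSet ℬ hG.mem) v) :
    iSupIndep (MTilde.component 𝒜 ℬ (moduleComponent v)) := by
  obtain ⟨a, b, ha0, hb0, ha, hb, hinj⟩ := exists_injective_character F n
  obtain ⟨T, hT⟩ := hG.exists_scaling_MTilde hV ha0 hb0 ha hb
  exact iSupIndep_of_scaling hinj hT

/-! ### Graded submodules avoiding `V` -/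

/-- The sum of the components of `M̃(V)` of nonzero `ℤ`-degree. -/
def MTilde.offZero (𝒜 : (Fin n → ℤ) → Submodule F G) (ℬ : ℤ → Submodule F G) [GradedLieAlgebra ℬ]
    {V : Type*} [AddCommGroup V] [Module F V] [LieRingModule (zeroPart ℬ) V]
    [LieModule F (zeroPart ℬ) V] (𝒱 : (Fin n → ℤ) → Submodule F V) : Submodule F (MTilde ℬ V) :=
  ⨆ γ ∈ {γ : ℤ × (Fin n → ℤ) | γ.1 ≠ 0}, MTilde.component 𝒜 ℬ 𝒱 γ

lemma IsExtragraded.disjoint_offZero [CharZero F] (hG : IsExtragraded 𝒜 ℬ g deg)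
    (hV : IsExpPolynomialModule (zeroSpanningSet ℬ hG.mem) v) :
    Disjoint (MTilde.offZero 𝒜 ℬ (moduleComponent v))
      (LinearMap.range (Ind.incl (inflate ℬ V))) := by
  have h := (hG.iSupIndep_component hV).disjoint_biSup_biSup
    (s := {γ : ℤ × (Fin n → ℤ) | γ.1 ≠ 0}) (t := {γ : ℤ × (Fin n → ℤ) | γ.1 = 0})
    (Set.disjoint_left.2 fun γ h h' => h h')
  refine h.mono_right ?_
  rintro _ ⟨y, rfl⟩
  have hy : y ∈ Submodule.span F (Set.range v) := by rw [v.span_eq]; trivial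
  induction hy using Submodule.span_induction with
  | mem y h =>
    obtain ⟨⟨j, β⟩, rfl⟩ := h
    have := hG.mk_word_mem_component (v := v) (X := Unit) [] () j β
    exact Submodule.mem_iSup_of_mem _ (Submodule.mem_iSup_of_mem (by simp) this)
  | zero => rw [map_zero]; exact Submodule.zero_mem _
  | add a b _ _ ha hb => rw [map_add]; exact add_mem ha hb
  | smul c a _ ha => rw [map_smul]; exact Submodule.smul_mem _ _ ha

/-- The components of `ℤ`-degree `0` lie in the image of `V`, so a graded submodule avoiding `V` has
no homogeneous elements there except zero. Unlike trivial intersection, the new condition visibly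
passes to sums. -/
lemma IsExtragraded.isGradedAvoiding_iff [CharZero F] (hG : IsExtragraded 𝒜 ℬ g deg)
    (hV : IsExpPolynomialModule (zeroSpanningSet ℬ hG.mem) v)
    (N : Submodule (UniversalEnvelopingAlgebra F G) (MTilde ℬ V)) :
    IsGradedAvoiding 𝒜 ℬ (moduleComponent v) N ↔
      IsGradedSubmodule (MTilde.component 𝒜 ℬ (moduleComponent v)) N ∧
        N.restrictScalars F ≤ MTilde.offZero 𝒜 ℬ (moduleComponent v) := by
  refine and_congr_right fun hN => ⟨fun h => hN.trans (iSup_le fun γ => ?_), fun h => ?_⟩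
  · by_cases hγ : γ.1 = 0
    · have := h ▸ inf_le_inf_left (N.restrictScalars F) (hG.component_le_range hV hγ)
      exact this.trans bot_le
    · exact inf_le_right.trans
        (le_biSup (MTilde.component 𝒜 ℬ (moduleComponent v)) (i := γ) hγ)
  · exact ((hG.disjoint_offZero hV).mono_left h).eq_bot

lemma IsExtragraded.isGradedAvoiding_rad [CharZero F] (hG : IsExtragraded 𝒜 ℬ g deg)
    (hV : IsExpPolynomialModule (zeroSpanningSet ℬ hG.mem) v) :
    IsGradedAvoiding 𝒜 ℬ (moduleComponent v) (MTilde.rad 𝒜 ℬ (moduleComponent v)) := by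
  have key : ∀ S : Submodule F (MTilde ℬ V),
      (∀ N, IsGradedAvoiding 𝒜 ℬ (moduleComponent v) N → N.restrictScalars F ≤ S) →
      (MTilde.rad 𝒜 ℬ (moduleComponent v)).restrictScalars F ≤ S := by
    intro S hS x hx
    rw [Submodule.restrictScalars_mem, MTilde.rad, sSup_eq_iSup'] at hx
    induction hx using Submodule.iSup_induction' with
    | mem N x hx => exact hS N N.2 hx
    | zero => exact Submodule.zero_mem _
    | add x y _ _ hx hy => exact add_mem hx hy
  rw [hG.isGradedAvoiding_iff hV]
  refine ⟨key _ fun N hN => hN.1.trans (iSup_mono fun γ => inf_le_inf_right _ ?_),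
    key _ fun N hN => ((hG.isGradedAvoiding_iff hV N).1 hN).2⟩
  exact fun x hx => (le_sSup hN : N ≤ MTilde.rad 𝒜 ℬ (moduleComponent v)) hx

/-- A graded `N` is stable under `T`, so `T` descends to the quotient and separates the images of
the components by the same eigenvalues. -/
lemma isInternal_map_mkQ {F U M Γ : Type*} [Field F] [Ring U] [Algebra F U] [AddCommGroup M]
    [Module F M] [Module U M] [IsScalarTower F U M] [DecidableEq Γ] {ℳ : Γ → Submodule F M}
    (hsup : ⨆ γ, ℳ γ = ⊤) {T : Module.End F M} {χ : Γ → F} (hχ : Function.Injective χ)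
    (hT : ∀ γ, ∀ m ∈ ℳ γ, T m = χ γ • m) {N : Submodule U M}
    (hN : N.restrictScalars F ≤ ⨆ γ, N.restrictScalars F ⊓ ℳ γ) :
    DirectSum.IsInternal fun γ => (ℳ γ).map (N.mkQ.restrictScalars F) := by
  have hTN : N.restrictScalars F ≤
      LinearMap.ker ((N.mkQ.restrictScalars F) ∘ₗ T) := by
    refine hN.trans (iSup_le fun γ => ?_)
    rintro m ⟨hm, hm'⟩
    have hm : m ∈ N := hm
    rw [LinearMap.mem_ker, LinearMap.comp_apply, hT γ m hm', map_smul]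
    simp [hm]
  let T' : Module.End F (M ⧸ N) := (N.restrictScalars F).liftQ _ hTN ∘ₗ
    (Submodule.Quotient.restrictScalarsEquiv F N).symm.toLinearMap
  have hT' : ∀ m, T' (N.mkQ m) = N.mkQ (T m) := fun m => rfl
  rw [DirectSum.isInternal_submodule_iff_iSupIndep_and_iSup_eq_top]
  refine ⟨iSupIndep_of_scaling (T := T') hχ ?_, ?_⟩
  · rintro γ _ ⟨m, hm, rfl⟩
    change T' (N.mkQ m) = _
    rw [hT', hT γ m hm]
    exact map_smul (N.mkQ.restrictScalars F) _ _
  · rw [← Submodule.map_iSup, hsup, Submodule.map_top, LinearMap.range_eq_top]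
    exact N.mkQ_surjective

lemma IsExtragraded.isInternal_component [CharZero F] (hG : IsExtragraded 𝒜 ℬ g deg)
    (hV : IsExpPolynomialModule (zeroSpanningSet ℬ hG.mem) v) :
    DirectSum.IsInternal (MQuot.component 𝒜 ℬ (moduleComponent v)) := by
  obtain ⟨a, b, ha0, hb0, ha, hb, hinj⟩ := exists_injective_character F n
  obtain ⟨T, hT⟩ := hG.exists_scaling_MTilde hV ha0 hb0 ha hb
  exact isInternal_map_mkQ hG.iSup_component hinj hT (hG.isGradedAvoiding_rad hV).1

/-- The submodule generated by `w` is spanned by the homogeneous elements obtained from `w` by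
words; by hypothesis those of `ℤ`-degree `0` vanish. -/
lemma IsExtragraded.mem_rad [CharZero F] (hG : IsExtragraded 𝒜 ℬ g deg)
    (hV : IsExpPolynomialModule (zeroSpanningSet ℬ hG.mem) v) {γ : ℤ × (Fin n → ℤ)}
    {w : MTilde ℬ V} (hw : w ∈ MTilde.component 𝒜 ℬ (moduleComponent v) γ)
    (h : ∀ l : List (K × (Unit → Fin n → ℤ)), wordDeg deg l + γ.1 = 0 →
      word F g l () • w = 0) :
    w ∈ MTilde.rad 𝒜 ℬ (moduleComponent v) := by
  let N := Submodule.span (UniversalEnvelopingAlgebra F G) {w}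
  have hwN : w ∈ N := Submodule.mem_span_singleton_self w
  suffices hN : IsGradedAvoiding 𝒜 ℬ (moduleComponent v) N from
    (le_sSup hN : N ≤ MTilde.rad 𝒜 ℬ (moduleComponent v)) hwN
  have key : ∀ S : Submodule F (MTilde ℬ V),
      (∀ l : List (K × (Unit → Fin n → ℤ)), word F g l () • w ∈ S) → N.restrictScalars F ≤ S := by
    intro S hS x hx
    obtain ⟨u, rfl⟩ := Submodule.mem_span_singleton.1 hx
    have hu : u ∈ Submodule.span F
        (Set.range fun l : List (K × (Unit → Fin n → ℤ)) => word F g l ()) := by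
      rw [hG.span_word]; trivial
    clear hx
    induction hu using Submodule.span_induction with
    | mem u h => obtain ⟨l, rfl⟩ := h; exact hS l
    | zero => rw [zero_smul]; exact Submodule.zero_mem _
    | add a b _ _ ha hb => rw [add_smul]; exact add_mem ha hb
    | smul c a _ ha => rw [smul_assoc]; exact Submodule.smul_mem _ _ ha
  rw [hG.isGradedAvoiding_iff hV]
  refine ⟨key _ fun l => Submodule.mem_iSup_of_mem _
    ⟨Submodule.smul_mem N _ hwN, hG.word_smul_mem_component l () hw⟩, key _ fun l => ?_⟩
  by_cases hl : wordDeg deg l + γ.1 = 0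
  · rw [h l hl]
    exact Submodule.zero_mem _
  · exact Submodule.mem_iSup_of_mem _ (Submodule.mem_iSup_of_mem hl
      (hG.word_smul_mem_component l () hw))

/-- In `mem_rad` it suffices to test words whose letters have positive `ℤ`-degree. -/
theorem IsExtragraded.mem_rad_of_pos [CharZero F] (hG : IsExtragraded 𝒜 ℬ g deg)
    (hV : IsExpPolynomialModule (zeroSpanningSet ℬ hG.mem) v) {γ : ℤ × (Fin n → ℤ)}
    {w : MTilde ℬ V} (hw : w ∈ MTilde.component 𝒜 ℬ (moduleComponent v) γ)
    (h : ∀ l : List (K × (Unit → Fin n → ℤ)), (∀ p ∈ l, 0 < deg p.1) → wordDeg deg l + γ.1 = 0 →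
      word F g l () • w = 0) :
    w ∈ MTilde.rad 𝒜 ℬ (moduleComponent v) := by
  refine hG.mem_rad hV hw fun l hl => ?_
  induction hN : l.length using Nat.strong_induction_on generalizing l with
  | _ N ih =>
  by_cases hpos : ∀ p ∈ l, 0 < deg p.1
  · exact h l hpos hl
  push Not at hpos
  obtain ⟨p, hpl, hp⟩ := hpos
  obtain ⟨s, t, rfl⟩ := List.append_of_mem hpl
  -- With `p` moved to the left end, the remaining letters send `w` to degree `-deg p ≥ 0`. This is
  -- zero for lack of components of positive degree, or, if `deg p = 0`, by induction.
  have h₁ : word F g (p :: (s ++ t)) () • w = 0 := by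
    rw [word_cons, mul_smul]
    have hd : wordDeg deg (s ++ t) + γ.1 = - deg p.1 := by
      simp only [wordDeg_append, wordDeg_cons] at hl ⊢
      omega
    rcases hp.lt_or_eq with hp | hp
    · have h₂ := hG.word_smul_mem_component (s ++ t) () hw
      rw [hG.component_eq_bot hV (by rw [Prod.fst_add, hd]; omega), Submodule.mem_bot] at h₂
      rw [h₂, smul_zero]
    · rw [ih (s ++ t).length (by simp [← hN]) (s ++ t) (by omega) rfl, smul_zero]
  -- Moving `p` changes the word by shorter words of the same degree, which kill `w` by induction.
  have h₂ := word_perm_sub_mem (F := F) hG.hasGradedBracket (isSubstClosed_top (X := Unit))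
    (List.perm_middle (a := p) (l₁ := s) (l₂ := t)) fun _ _ => trivial
  have h₃ : ∀ Ψ ∈ shortWords g deg (⊤ : Subalgebra F (Unit → F)) ⊤ (s ++ p :: t).length
      (wordDeg deg (s ++ p :: t)) (wordShift (s ++ p :: t)), Ψ () • w = 0 := by
    intro Ψ hΨ
    induction hΨ using Submodule.span_induction with
    | mem Ψ h =>
      obtain ⟨c, -, l', hl', -, hd', -, rfl⟩ := h
      rw [smul_assoc, ih l'.length (hN ▸ hl') l' (hd' ▸ hl) rfl, smul_zero]
    | zero => exact zero_smul _ w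
    | add a b _ _ ha hb => rw [Pi.add_apply, add_smul, ha, hb, add_zero]
    | smul c a _ ha => rw [Pi.smul_apply, smul_assoc, ha, smul_zero]
  have h₄ := h₃ _ h₂
  rw [Pi.sub_apply, sub_smul, h₁, sub_zero] at h₄
  exact h₄

end Radical

/-! ### Functions of finite rank -/

section FiniteRank

variable (F : Type*) [Field F] (Y Z : Type*)

/-- The functions `f` of two variables such that the functions `f(·, z)` span a finite-dimensional
space. -/
def finiteRank : Subalgebra F (Y × Z → F) where
  carrier := {f | ∃ S : Submodule F (Y → F), S.FG ∧ ∀ z, (fun y => f (y, z)) ∈ S}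
  mul_mem' := by
    rintro f₁ f₂ ⟨S₁, h₁, h₁'⟩ ⟨S₂, h₂, h₂'⟩
    exact ⟨S₁ * S₂, h₁.mul h₂, fun z => Submodule.mul_mem_mul (h₁' z) (h₂' z)⟩
  add_mem' := by
    rintro f₁ f₂ ⟨S₁, h₁, h₁'⟩ ⟨S₂, h₂, h₂'⟩
    exact ⟨S₁ ⊔ S₂, h₁.sup h₂, fun z => Submodule.add_mem_sup (h₁' z) (h₂' z)⟩
  algebraMap_mem' c := ⟨Submodule.span F {fun _ => c}, Submodule.fg_span_singleton _,
    fun _ => Submodule.mem_span_singleton_self _⟩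

/-- The functions of the form `A(y) + B(z)`. -/
def additivelySeparable (n : ℕ) : AddSubmonoid (Y × Z → Fin n → ℤ) where
  carrier := {L | ∃ (A : Y → Fin n → ℤ) (B : Z → Fin n → ℤ), ∀ x, L x = A x.1 + B x.2}
  zero_mem' := ⟨0, 0, fun x => by simp⟩
  add_mem' := by
    rintro L₁ L₂ ⟨A₁, B₁, h₁⟩ ⟨A₂, B₂, h₂⟩
    exact ⟨A₁ + A₂, B₁ + B₂, fun x => by simp only [Pi.add_apply, h₁, h₂]; abel⟩

/-- A coordinate of `A(y) + B(z)` lies in the span of a function of `y` and the constant `1`, and `a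
^ (A + B)` splits as a product. Finite rank is preserved by sums and products, so checking these
generators suffices. -/
theorem isSubstClosed_finiteRank (n : ℕ) :
    IsSubstClosed (finiteRank F Y Z) (additivelySeparable Y Z n) := by
  rintro ⟨f, hf⟩ L₁ ⟨A₁, B₁, h₁⟩ L₂ ⟨A₂, B₂, h₂⟩
  have hL : ∀ i y z, Sum.elim (L₁ (y, z)) (L₂ (y, z)) i =
      Sum.elim (A₁ y) (A₂ y) i + Sum.elim (B₁ z) (B₂ z) i := by
    rintro (i | i) y z <;> simp [h₁, h₂]
  change (fun x => f (Sum.elim (L₁ x) (L₂ x))) ∈ finiteRank F Y Z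
  induction hf using Algebra.adjoin_induction with
  | mem f hf =>
    rcases hf with ⟨i, rfl⟩ | ⟨⟨a, i⟩, rfl⟩
    · refine ⟨Submodule.span F {fun y => ((Sum.elim (A₁ y) (A₂ y) i : ℤ) : F), fun _ => 1},
        Submodule.fg_span (by simp), fun z => ?_⟩
      refine Submodule.mem_span_pair.2 ⟨1, (Sum.elim (B₁ z) (B₂ z) i : ℤ), ?_⟩
      ext y
      simp [hL]
    · refine ⟨Submodule.span F {fun y => (a : F) ^ (Sum.elim (A₁ y) (A₂ y) i)},
        Submodule.fg_span_singleton _, fun z => ?_⟩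
      refine Submodule.mem_span_singleton.2 ⟨(a : F) ^ (Sum.elim (B₁ z) (B₂ z) i), ?_⟩
      ext y
      simp only [Pi.smul_apply, smul_eq_mul, hL, zpow_add₀ a.ne_zero]
      ring
  | algebraMap c => exact (finiteRank F Y Z).algebraMap_mem c
  | add f₁ f₂ _ _ h₁ h₂ => exact add_mem h₁ h₂
  | mul f₁ f₂ _ _ h₁ h₂ => exact mul_mem h₁ h₂

end FiniteRank

/-! ### Words of a given type -/

section Tagging

variable {F G : Type*} [Field F] [LieRing G] [LieAlgebra F G] {n : ℕ} {K X X' : Type*}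
  {g : K → (Fin n → ℤ) → G} {deg : K → ℤ}

/-- The word with letters `τ_i` and parameters `f_i`. -/
def taggedWord : List K → (ℕ → X → Fin n → ℤ) → List (K × (X → Fin n → ℤ))
  | [], _ => []
  | k :: τ, f => (k, f 0) :: taggedWord τ fun i => f (i + 1)

lemma mem_taggedWord {τ : List K} {f : ℕ → X → Fin n → ℤ} {p : K × (X → Fin n → ℤ)}
    (hp : p ∈ taggedWord τ f) : ∃ i, p.2 = f i := by
  induction τ generalizing f with
  | nil => simp [taggedWord] at hp
  | cons k τ ih =>
    rcases List.mem_cons.1 hp with rfl | hp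
    · exact ⟨0, rfl⟩
    · obtain ⟨i, hi⟩ := ih hp
      exact ⟨i + 1, hi⟩

lemma wordDeg_taggedWord (τ : List K) (f : ℕ → X → Fin n → ℤ) :
    wordDeg deg (taggedWord τ f) = (τ.map deg).sum := by
  induction τ generalizing f with
  | nil => rfl
  | cons k τ ih => simp [taggedWord, ih]

lemma word_taggedWord_congr (τ : List K) {f : ℕ → X → Fin n → ℤ} {f' : ℕ → X' → Fin n → ℤ} {x : X}
    {x' : X'} (h : ∀ i, f i x = f' i x') :
    word F g (taggedWord τ f) x = word F g (taggedWord τ f') x' := by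
  induction τ generalizing f f' with
  | nil => rfl
  | cons k τ ih => simp only [taggedWord, word_cons, h, ih fun i => h (i + 1)]

lemma wordShift_taggedWord_congr (τ : List K) {f : ℕ → X → Fin n → ℤ} {f' : ℕ → X' → Fin n → ℤ}
    {x : X} {x' : X'} (h : ∀ i, f i x = f' i x') :
    wordShift (taggedWord τ f) x = wordShift (taggedWord τ f') x' := by
  induction τ generalizing f f' with
  | nil => rfl
  | cons k τ ih =>
    simp only [taggedWord, wordShift_cons, Pi.add_apply, h, ih fun i => h (i + 1)]

lemma exists_eval_taggedWord (l : List (K × (X → Fin n → ℤ))) (x : X) :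
    ∃ z : ℕ → Fin n → ℤ, word F g (taggedWord (l.map Prod.fst) fun i z => z i) z = word F g l x ∧
      wordShift (taggedWord (l.map Prod.fst) fun i z => z i) z = wordShift l x := by
  induction l with
  -- Entries beyond the length of the word are never read, so any filler would do.
  | nil => exact ⟨0, rfl, rfl⟩
  | cons p l ih =>
    obtain ⟨z, h₁, h₂⟩ := ih
    refine ⟨fun i => Nat.casesOn i (p.2 x) z, ?_, ?_⟩
    · rw [word_cons, ← h₁]
      simp only [List.map_cons, taggedWord, word_cons]
      congr 1
      exact word_taggedWord_congr _ fun i => rfl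
    · rw [wordShift_cons, Pi.add_apply, ← h₂]
      simp only [List.map_cons, taggedWord, wordShift_cons, Pi.add_apply]
      congr 1
      exact wordShift_taggedWord_congr _ fun i => rfl

/-- Each letter contributes at least `1`, so removing the head lowers the bound on the sum, and the
head comes from finitely many finite sets `K_i`. -/
lemma finite_lists_of_pos (hdeg : ∀ i, {k | deg k = i}.Finite) (m : ℤ) :
    {τ : List K | (∀ k ∈ τ, 0 < deg k) ∧ (τ.map deg).sum = m}.Finite := by
  have hK : ∀ N : ℕ, {k | 0 < deg k ∧ deg k ≤ N}.Finite := fun N =>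
    ((Set.finite_Icc (0 : ℤ) N).biUnion fun i _ => hdeg i).subset fun k hk =>
      Set.mem_biUnion (x := deg k) ⟨hk.1.le, hk.2⟩ rfl
  have key : ∀ N : ℕ, {τ : List K | (∀ k ∈ τ, 0 < deg k) ∧ (τ.map deg).sum ≤ N}.Finite := by
    intro N
    induction N with
    | zero =>
      refine (Set.finite_singleton []).subset ?_
      rintro (_ | ⟨k, τ⟩) ⟨h, hs⟩
      · rfl
      · have h₁ := h k (by simp)
        have h₂ : 0 ≤ (τ.map deg).sum := List.sum_nonneg fun i hi => by
          obtain ⟨r, hr, rfl⟩ := List.mem_map.1 hi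
          exact (h r (by simp [hr])).le
        simp at hs
        omega
    | succ N ih =>
      refine (((hK (N + 1)).image2 List.cons ih).insert []).subset ?_
      rintro (_ | ⟨k, τ⟩) ⟨h, hs⟩
      · exact Set.mem_insert _ _
      · have h₁ := h k (by simp)
        have h₂ : 0 ≤ (τ.map deg).sum := List.sum_nonneg fun i hi => by
          obtain ⟨r, hr, rfl⟩ := List.mem_map.1 hi
          exact (h r (by simp [hr])).le
        rw [List.map_cons, List.sum_cons] at hs
        push_cast at hs
        refine Set.mem_insert_of_mem _ ⟨k, ⟨h₁, by push_cast; omega⟩, τ,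
          ⟨fun r hr => h r (by simp [hr]), by omega⟩, rfl⟩
  refine (key m.toNat).subset fun τ hτ => ⟨hτ.1, ?_⟩
  rw [hτ.2]
  exact Int.self_le_toNat m

lemma finite_lists_of_neg (hdeg : ∀ i, {k | deg k = i}.Finite) (m : ℤ) :
    {τ : List K | (∀ k ∈ τ, deg k < 0) ∧ (τ.map deg).sum = m}.Finite := by
  refine (finite_lists_of_pos (deg := fun k => - deg k) (fun i => ?_) (-m)).subset ?_
  · simpa [neg_eq_iff_eq_neg] using hdeg (-i)
  · rintro τ ⟨h, hs⟩
    refine ⟨fun k hk => neg_pos.2 (h k hk), ?_⟩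
    rw [← hs, List.sum_neg, List.map_map]
    rfl

end Tagging

/-! ### Finite-dimensionality -/

lemma finiteDimensional_map_of_inf_ker_le {F M P Q : Type*} [Field F] [AddCommGroup M] [Module F M]
    [AddCommGroup P] [Module F P] [AddCommGroup Q] [Module F Q] {W : Submodule F M}
    {S : Submodule F P} (hS : S.FG) (Ψ : M →ₗ[F] P) (q : M →ₗ[F] Q) (hW : W ≤ S.comap Ψ)
    (hker : W ⊓ LinearMap.ker Ψ ≤ LinearMap.ker q) : FiniteDimensional F (W.map q) := by
  have : FiniteDimensional F S := Module.Finite.iff_fg.2 hS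
  let f : W →ₗ[F] S := (Ψ ∘ₗ W.subtype).codRestrict S fun w => hW w.2
  have hf : LinearMap.ker f ≤ LinearMap.ker (q ∘ₗ W.subtype) := fun w hw =>
    hker ⟨w.2, congrArg Subtype.val (LinearMap.mem_ker.1 hw)⟩
  have : FiniteDimensional F (W ⧸ LinearMap.ker f) :=
    Module.Finite.equiv f.quotKerEquivRange.symm
  have h : W.map q = LinearMap.range ((LinearMap.ker f).liftQ _ hf) := by
    rw [Submodule.range_liftQ, LinearMap.range_comp, Submodule.range_subtype]
  rw [h]
  infer_instance

section FiniteDimensional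

variable {F G : Type*} [Field F] [LieRing G] [LieAlgebra F G] {n : ℕ}
  {V : Type*} [AddCommGroup V] [Module F V]

/-- Negative letters of total degree `0` form the empty word, so only `c(y, z) v_j(L(y))` remains.
The vector does not depend on `z`, and `c` has finite rank. -/
lemma exists_fg_of_mem_normalForms {P : LieSubalgebra F G} {ρ : P →ₗ⁅F⁆ Module.End F V}
    {K J Y Z : Type*} {g : K → (Fin n → ℤ) → G} {deg : K → ℤ} {v : J × (Fin n → ℤ) → V}
    (L : Y → Fin n → ℤ) {Φ : Y × Z → Ind ρ}
    (hΦ : Φ ∈ normalForms ρ g deg v (finiteRank F Y Z) (additivelySeparable Y Z n) 0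
      (fun x => L x.1)) :
    ∃ S : Submodule F (Y → Ind ρ), S.FG ∧ ∀ z, (fun y => Φ (y, z)) ∈ S := by
  induction hΦ using Submodule.span_induction with
  | mem Φ h =>
    obtain ⟨c, ⟨S, hS, hc⟩, l, j, B, -, -, hn, hd, hL, rfl⟩ := h
    obtain rfl := (wordDeg_nonpos hn).2 hd
    let f : (Y → F) →ₗ[F] (Y → Ind ρ) := LinearMap.pi fun y =>
      (LinearMap.proj y : (Y → F) →ₗ[F] F).smulRight (Ind.mk ρ 1 (v (j, L y)))
    refine ⟨S.map f, hS.map f, fun z => ⟨_, hc z, ?_⟩⟩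
    ext y
    have hB : B (y, z) = L y := by simpa using congrFun hL (y, z)
    simp [f, hB]
  | zero => exact ⟨⊥, Submodule.fg_bot, fun z => Submodule.zero_mem _⟩
  | add Φ₁ Φ₂ _ _ h₁ h₂ =>
    obtain ⟨S₁, h₁, h₁'⟩ := h₁
    obtain ⟨S₂, h₂, h₂'⟩ := h₂
    exact ⟨S₁ ⊔ S₂, h₁.sup h₂, fun z => Submodule.add_mem_sup (h₁' z) (h₂' z)⟩
  | smul c Φ _ h =>
    obtain ⟨S, h, h'⟩ := h
    exact ⟨S, h, fun z => Submodule.smul_mem S c (h' z)⟩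

variable {𝒜 : (Fin n → ℤ) → Submodule F G} [GradedLieAlgebra 𝒜]
  {ℬ : ℤ → Submodule F G} [GradedLieAlgebra ℬ]
  {K : Type*} {g : K → (Fin n → ℤ) → G} {deg : K → ℤ}
  [LieRingModule (zeroPart ℬ) V] [LieModule F (zeroPart ℬ) V]
  {J : Type*} {v : Module.Basis (J × (Fin n → ℤ)) F V}

/-- Acting by the words of type `τ`, as functions of their parameters. -/
def wordAction (ℬ : ℤ → Submodule F G) [GradedLieAlgebra ℬ] (V : Type*) [AddCommGroup V]
    [Module F V] [LieRingModule (zeroPart ℬ) V] [LieModule F (zeroPart ℬ) V]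
    (g : K → (Fin n → ℤ) → G) (τ : List K) :
    MTilde ℬ V →ₗ[F] ((ℕ → Fin n → ℤ) → MTilde ℬ V) where
  toFun m y := word F g (taggedWord τ fun i z => z i) y • m
  map_add' m m' := funext fun _ => smul_add _ m m'
  map_smul' c m := funext fun _ => smul_comm _ c m

lemma IsExtragraded.exists_fg_word_mul_word (hG : IsExtragraded 𝒜 ℬ g deg)
    (hV : IsExpPolynomialModule (zeroSpanningSet ℬ hG.mem) v) (γ : ℤ × (Fin n → ℤ))
    {τ τ' : List K} (hτ : (τ.map deg).sum + γ.1 = 0) (j : J) (hτ' : (τ'.map deg).sum = γ.1) :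
    ∃ S : Submodule F ((ℕ → Fin n → ℤ) → MTilde ℬ V), S.FG ∧ ∀ z : ℕ → Fin n → ℤ,
      (fun y => Ind.mk (inflate ℬ V) (word F g (taggedWord τ fun i z => z i) y *
        word F g (taggedWord τ' fun i z => z i) z)
        (v (j, γ.2 - wordShift (taggedWord τ' fun i z => z i) z))) ∈ S := by
  let Y := ℕ → Fin n → ℤ
  let l₁ : List (K × (Y × Y → Fin n → ℤ)) := taggedWord τ fun i x => x.1 i
  let l₂ : List (K × (Y × Y → Fin n → ℤ)) := taggedWord τ' fun i x => x.2 i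
  -- This argument of `v_j` puts the vector in degree `γ`; the total `ℤⁿ`-degree after acting by the
  -- first word then depends on `y` alone.
  let B : Y × Y → Fin n → ℤ := fun x => γ.2 - wordShift (taggedWord τ' fun i z => z i) x.2
  have hl : ∀ p ∈ l₁ ++ l₂, p.2 ∈ additivelySeparable Y Y n := by
    intro p hp
    rcases List.mem_append.1 hp with hp | hp
    · obtain ⟨i, hi⟩ := mem_taggedWord hp
      exact ⟨fun y => y i, 0, fun x => by simp [hi]⟩
    · obtain ⟨i, hi⟩ := mem_taggedWord hp
      exact ⟨0, fun y => y i, fun x => by simp [hi]⟩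
  have hB : B ∈ additivelySeparable Y Y n :=
    ⟨0, fun z => γ.2 - wordShift (taggedWord τ' fun i z => z i) z, fun x => by simp [B]⟩
  have h := mk_word_mem_normalForms hG.hasGradedBracket (isSubstClosed_finiteRank F Y Y n)
    (hG.hasHighestWeightAction hV) _ (l₁ ++ l₂) rfl hl j B hB
  have hd : wordDeg deg (l₁ ++ l₂) = 0 := by
    rw [wordDeg_append, wordDeg_taggedWord, wordDeg_taggedWord, hτ', hτ]
  have hL : wordShift (l₁ ++ l₂) + B =
      fun x => wordShift (taggedWord τ fun i z => z i) x.1 + γ.2 := by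
    funext x
    have h₁ : wordShift l₁ x = wordShift (taggedWord τ fun i z => z i) x.1 :=
      wordShift_taggedWord_congr _ fun i => rfl
    have h₂ : wordShift l₂ x = wordShift (taggedWord τ' fun i z => z i) x.2 :=
      wordShift_taggedWord_congr _ fun i => rfl
    simp only [wordShift_append, Pi.add_apply, h₁, h₂, B]
    abel
  rw [hd, hL] at h
  obtain ⟨S, hS, hS'⟩ := exists_fg_of_mem_normalForms (ρ := inflate ℬ V) (v := v) (g := g)
    (deg := deg) (Y := ℕ → Fin n → ℤ) (Z := ℕ → Fin n → ℤ)
    (fun y => wordShift (taggedWord τ fun i z => z i) y + γ.2)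
    (Φ := fun x => Ind.mk (inflate ℬ V) (word F g (l₁ ++ l₂) x) (v (j, B x))) h
  refine ⟨S, hS, fun z => ?_⟩
  have hw : ∀ y, word F g (l₁ ++ l₂) (y, z) = word F g (taggedWord τ fun i z => z i) y *
      word F g (taggedWord τ' fun i z => z i) z := fun y => by
    rw [word_append]
    exact congrArg₂ _ (word_taggedWord_congr _ fun i => rfl) (word_taggedWord_congr _ fun i => rfl)
  have h' := hS' z
  simp only [hw] at h'
  exact h'

/-- The words of a given type map a homogeneous component of `M̃(V)` into `V` by functions which
span a finite-dimensional space. -/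
theorem IsExtragraded.exists_fg_wordAction [Finite J] (hG : IsExtragraded 𝒜 ℬ g deg)
    (hV : IsExpPolynomialModule (zeroSpanningSet ℬ hG.mem) v) (γ : ℤ × (Fin n → ℤ)) (τ : List K)
    (hτ : (τ.map deg).sum + γ.1 = 0) :
    ∃ S : Submodule F ((ℕ → Fin n → ℤ) → MTilde ℬ V), S.FG ∧
      MTilde.component 𝒜 ℬ (moduleComponent v) γ ≤ S.comap (wordAction ℬ V g τ) := by
  -- Finitely many types of negative words and finitely many `j` span the component, so the sum of
  -- the spaces found for each pair is still finitely generated.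
  let T := {τ' : List K | (∀ k ∈ τ', deg k < 0) ∧ (τ'.map deg).sum = γ.1}
  have : Finite T := finite_lists_of_neg hG.finite_deg γ.1
  have hsum : ∀ τ' : T, (τ'.1.map deg).sum = γ.1 := fun τ' => τ'.2.2
  choose S hS hS' using fun p : T × J =>
    hG.exists_fg_word_mul_word hV γ hτ p.2 (hsum p.1)
  refine ⟨⨆ p, S p, Submodule.fg_iSup _ hS,
    (hG.component_le_span_neg hV γ).trans (Submodule.span_le.2 ?_)⟩
  rintro _ ⟨l, j, β, hn, hd, hL, rfl⟩
  obtain ⟨z, hz, hz'⟩ := exists_eval_taggedWord (F := F) (g := g) l ()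
  have hT : l.map Prod.fst ∈ T := by
    refine ⟨fun k hk => ?_, by rw [List.map_map]; exact hd⟩
    obtain ⟨p, hp, rfl⟩ := List.mem_map.1 hk
    exact hn p hp
  refine Submodule.mem_iSup_of_mem (⟨_, hT⟩, j) ?_
  have h := hS' (⟨_, hT⟩, j) z
  simp only [hz, hz', ← hL, add_sub_cancel_left] at h
  simp only [← Ind.smul_mk] at h
  exact h

/-- The actions of the finitely many types of positive words of degree `-γ.1` together map the
component into a finite-dimensional space, and by `mem_rad_of_pos` what they kill lies in the
radical. -/
theorem IsExtragraded.finiteDimensional_component [CharZero F] [Finite J]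
    (hG : IsExtragraded 𝒜 ℬ g deg) (hV : IsExpPolynomialModule (zeroSpanningSet ℬ hG.mem) v)
    (γ : ℤ × (Fin n → ℤ)) :
    FiniteDimensional F (MQuot.component 𝒜 ℬ (moduleComponent v) γ) := by
  let T := {τ : List K | (∀ k ∈ τ, 0 < deg k) ∧ (τ.map deg).sum = - γ.1}
  have : Finite T := finite_lists_of_pos hG.finite_deg (-γ.1)
  choose S hS hS' using fun τ : T =>
    hG.exists_fg_wordAction hV γ τ (by rw [τ.2.2]; exact neg_add_cancel _)
  refine finiteDimensional_map_of_inf_ker_le (Submodule.fg_pi hS)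
    (LinearMap.pi fun τ : T => wordAction ℬ V g τ) _ (fun w hw τ _ => hS' τ hw) ?_
  rintro w ⟨hw, hw'⟩
  suffices w ∈ MTilde.rad 𝒜 ℬ (moduleComponent v) by simpa using this
  refine hG.mem_rad_of_pos hV hw fun l hl hd => ?_
  obtain ⟨y, hy, -⟩ := exists_eval_taggedWord (F := F) (g := g) l ()
  have hT : l.map Prod.fst ∈ T := by
    refine ⟨fun k hk => ?_, by rw [List.map_map]; exact eq_neg_of_add_eq_zero_left hd⟩
    obtain ⟨p, hp, rfl⟩ := List.mem_map.1 hk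
    exact hl p hp
  rw [← hy]
  exact congrFun (congrFun (LinearMap.mem_ker.1 hw') ⟨_, hT⟩) y

end FiniteDimensional

end ExpPolyLie

end

open ExpPolyLie in
theorem theorem1p5 {F : Type*} [Field F] [CharZero F]
    {G : Type*} [LieRing G] [LieAlgebra F G] {n : ℕ}
    (𝒜 : (Fin n → ℤ) → Submodule F G) [GradedLieAlgebra 𝒜]
    (ℬ : ℤ → Submodule F G) [GradedLieAlgebra ℬ]
    {K : Type*} (g : K → (Fin n → ℤ) → G) (deg : K → ℤ)
    (hG : IsExtragraded 𝒜 ℬ g deg)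
    {V : Type*} [AddCommGroup V] [Module F V]
    [LieRingModule (zeroPart ℬ) V] [LieModule F (zeroPart ℬ) V]
    {J : Type*} [Finite J] (v : Module.Basis (J × (Fin n → ℤ)) F V)
    (hV : IsExpPolynomialModule (zeroSpanningSet ℬ hG.mem) v) :
    IsGreatest {N | IsGradedAvoiding 𝒜 ℬ (moduleComponent v) N}
        (MTilde.rad 𝒜 ℬ (moduleComponent v)) ∧
      DirectSum.IsInternal (MQuot.component 𝒜 ℬ (moduleComponent v)) ∧
      ∀ (i : ℤ) (α : Fin n → ℤ),
        FiniteDimensional F (MQuot.component 𝒜 ℬ (moduleComponent v) (i, α)) := by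
  exact ⟨⟨hG.isGradedAvoiding_rad hV, fun N hN => le_sSup hN⟩, hG.isInternal_component hV,
    fun i α => hG.finiteDimensional_component hV (i, α)⟩
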